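/- Let $k>0$ (wave number), $\Lambda>0$ (period) and $\alpha\in\mathbb R$. For $n\in\mathbb Z$ put $\alpha_n=\alpha+\frac{2\pi}{\Lambda}n$, and $\beta_n=\sqrt{k^2-\alpha_n^2}$ if $|\alpha_n|\le k$, $\beta_n=i\sqrt{\alpha_n^2-k^2}$ if $|\alpha_n|>k$. Assume that $\alpha$ is not a Wood anomaly, i.e. $|\alpha_n|\ne k$ for all $n\in\mathbb Z$, and let $B_\alpha=\{n\in\mathbb Z:|\alpha_n|<k\}$ (a finite set). For $x,y\in\mathbb R^2$ let $$G^{qp}_\alpha(x,y)=\frac i4\sum_{n\in\mathbb Z}H^{(1)}_0(k|x-y_n|)\,e^{in\Lambda\alpha},\qquad y_n=(y_1+n\Lambda,\,y_2),$$ be the quasi-periodic Green's function, where $H_0^{(1)}=J_0+iY_0$ is the Hankel function of the first kind of order zero and the (conditionally convergent) series is the limit of its symmetric partial sums. For $h>0$ let $$\Gamma_h=\{x:-\tfrac\Lambda2<x_1<\tfrac\Lambda2,\ x_2=h\},\qquad \Omega_h^-=\{x:-\tfrac\Lambda2<x_1<\tfrac\Lambda2,\ x_2<h\},$$ and let $$F^U_\alpha(y,z)=\frac{i}{2\Lambda}\sum_{n\in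 B_\alpha}\frac1{\beta_n}e^{i\alpha_n(y_1-z_1)+i\beta_n(y_2-z_2)}.$$ (a) For all $h>0$ and $y,z\in\Omega_h^-$, the series defining $G^{qp}_\alpha(x,y)$ and $G^{qp}_\alpha(x,z)$ converge for $x$ on the line $x_2=h$, both functions are differentiable there with respect to $x_2$, the two products below are integrable on $\Gamma_h$, and $$\int_{\Gamma_h}\frac{\partial\overline{G^{qp}_\alpha(x,y)}}{\partial x_2}\,G^{qp}_\alpha(x,z)-\frac{\partial G^{qp}_\alpha(x,z)}{\partial x_2}\,\overline{G^{qp}_\alpha(x,y)}\,ds(x)=-F^U_\alpha(y,z).$$ (b) Define $R^U_\alpha(y,z;h)$ for $y,z\in\Omega_h^-$ by $$\int_{\Gamma_h}\frac{\partial\overline{G^{qp}_\alpha(x,y)}}{\partial x_2}\,G^{qp}_\alpha(x,z)\,ds(x)=-\frac12F^U_\alpha(y,z)+R^U_\alpha(y,z;h).$$ Then $|R^U_\alpha(y,z;h)|=O(h^{-1})$ and $|\nabla_{(y,z)} R^U_\alpha(y,z;h)|=O(h^{-1})$ as $h\to\infty$, uniformly for $y,z$ in bounded parts of the cell: for every $M$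 there are $C$ and $h_0>0$ such that for all $h\ge h_0$ and all $y,z\in\Omega_h^-$ with $|y_2|,|z_2|\le M$, the function $R^U_\alpha(\cdot,\cdot\,;h)$ is differentiable at $(y,z)$, and both $|R^U_\alpha(y,z;h)|$ and $|\nabla_{(y,z)}R^U_\alpha(y,z;h)|$ are at most $C/h$. -/

import Mathlib

open Complex ComplexConjugate

noncomputable section

namespace QuasiPeriodic

/-- The plane `ℝ²`; `x 0` and `x 1` are the horizontal and the vertical coordinate. -/
abbrev Plane : Type := EuclideanSpace ℝ (Fin 2)

/-- The Bessel function of the first kind of order zero,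
`J₀(r) = ∑ₘ (-1)ᵐ (r²/4)ᵐ / (m!)²`. -/
def besselJ0 (r : ℝ) : ℝ :=
  ∑' m : ℕ, (-1) ^ m * (r ^ 2 / 4) ^ m / (m.factorial : ℝ) ^ 2

/-- The Bessel function of the second kind of order zero, for `r > 0`,
`Y₀(r) = (2/π) (log (r/2) + γ) J₀(r) - (2/π) ∑ₘ (-1)ᵐ Hₘ (r²/4)ᵐ / (m!)²`,
with `γ` Euler's constant and `Hₘ` the harmonic numbers. -/
def besselY0 (r : ℝ) : ℝ :=
  2 / Real.pi * (Real.log (r / 2) + Real.eulerMascheroniConstant) * besselJ0 r -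
    2 / Real.pi *
      ∑' m : ℕ, (-1) ^ m * (harmonic m : ℝ) * (r ^ 2 / 4) ^ m / (m.factorial : ℝ) ^ 2

/-- The Hankel function of the first kind of order zero, `H₀⁽¹⁾ = J₀ + i Y₀`, for `r > 0`. -/
def hankelH0 (r : ℝ) : ℂ := (besselJ0 r : ℂ) + I * (besselY0 r : ℂ)

/-- `αₙ = α + 2πn/Λ`. -/
def alphaN (Λ α : ℝ) (n : ℤ) : ℝ := α + 2 * Real.pi / Λ * n

/-- `βₙ = √(k² - αₙ²)` if `|αₙ| ≤ k` and `βₙ = i √(αₙ² - k²)` if `|αₙ| > k`. -/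
def betaN (k Λ α : ℝ) (n : ℤ) : ℂ :=
  if |alphaN Λ α n| ≤ k then (Real.sqrt (k ^ 2 - alphaN Λ α n ^ 2) : ℂ)
  else I * (Real.sqrt (alphaN Λ α n ^ 2 - k ^ 2) : ℂ)

/-- `α` is a Wood anomaly for the wave number `k` if `|αₙ| = k` for some `n`. -/
def IsWoodAnomaly (k Λ α : ℝ) : Prop := ∃ n : ℤ, |alphaN Λ α n| = k

/-- The index set `B_α` of the propagating modes. -/
def propagating (k Λ α : ℝ) : Set ℤ := {n | |alphaN Λ α n| < k}

/-- There are only finitely many propagating modes, so that a finite sum over them makes sense. -/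
theorem propagating_finite (k Λ α : ℝ) (hΛ : 0 < Λ) : (propagating k Λ α).Finite := by
  have hc : 0 < 2 * Real.pi / Λ := by positivity
  refine (Set.finite_Icc (-⌈(k + |α|) / (2 * Real.pi / Λ)⌉)
    ⌈(k + |α|) / (2 * Real.pi / Λ)⌉).subset ?_
  intro n hn
  have h1 : |α + 2 * Real.pi / Λ * n| < k := hn
  obtain ⟨h2, h3⟩ := abs_lt.mp h1
  have h4 := neg_abs_le α
  have h5 := le_abs_self α
  have h6 := Int.le_ceil ((k + |α|) / (2 * Real.pi / Λ))
  have h7 : (n : ℝ) ≤ (k + |α|) / (2 * Real.pi / Λ) := by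
    rw [le_div_iff₀ hc]; linarith
  have h8 : -(n : ℝ) ≤ (k + |α|) / (2 * Real.pi / Λ) := by
    rw [le_div_iff₀ hc]; linarith
  constructor
  · have : -(n : ℝ) ≤ (⌈(k + |α|) / (2 * Real.pi / Λ)⌉ : ℝ) := h8.trans h6
    have : -n ≤ ⌈(k + |α|) / (2 * Real.pi / Λ)⌉ := by exact_mod_cast this
    linarith
  · exact_mod_cast h7.trans h6

/-- The periodic images `yₙ = (y₁ + nΛ, y₂)` of a source point `y`. -/
def image (Λ : ℝ) (y : Plane) (n : ℤ) : Plane := !₂[y 0 + n * Λ, y 1]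

/-- The terms `(i/4) H₀⁽¹⁾(k |x - yₙ|) e^{inΛα}` of the quasi-periodic Green's function. -/
def greenTerm (k Λ α : ℝ) (x y : Plane) (n : ℤ) : ℂ :=
  I / 4 * hankelH0 (k * dist x (image Λ y n)) * cexp (I * n * Λ * α)

/-- The quasi-periodic Green's function `(i/4) ∑_{n ∈ ℤ} H₀⁽¹⁾(k |x - yₙ|) e^{inΛα}`. The series
is only conditionally convergent; its value is the limit of the sums over `-N ≤ n ≤ N`. -/
def green (k Λ α : ℝ) (x y : Plane) : ℂ :=
  ∑'[SummationFilter.symmetricIcc ℤ] n : ℤ, greenTerm k Λ α x y n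

/-- The partial derivative `∂f/∂x₂`. -/
def vertDeriv (f : Plane → ℂ) (x : Plane) : ℂ := deriv (fun t : ℝ => f !₂[x 0, t]) (x 1)

/-- The integral `∫_{Γ_h} f ds` over the segment `Γ_h = {x | -Λ/2 < x₁ < Λ/2, x₂ = h}`. -/
def segIntegral (Λ h : ℝ) (f : Plane → ℂ) : ℂ := ∫ t in (-(Λ / 2))..(Λ / 2), f !₂[t, h]

/-- Integrability on the segment `Γ_h`. -/
def SegIntegrable (Λ h : ℝ) (f : Plane → ℂ) : Prop :=
  IntervalIntegrable (fun t : ℝ => f !₂[t, h]) MeasureTheory.volume (-(Λ / 2)) (Λ / 2)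

/-- The part `Ω_h⁻` of the periodic cell `{x | -Λ/2 < x₁ < Λ/2}` that lies below `Γ_h`. -/
def cellBelow (Λ h : ℝ) : Set Plane := {x | x 0 ∈ Set.Ioo (-(Λ / 2)) (Λ / 2) ∧ x 1 < h}

/-- `F^U_α(y,z) = (i/(2Λ)) ∑_{n ∈ B_α} (1/βₙ) e^{iαₙ(y₁-z₁) + iβₙ(y₂-z₂)}`, a finite sum. -/
def pointSpreadU (k Λ α : ℝ) (y z : Plane) : ℂ :=
  I / (2 * Λ) * ∑ᶠ n ∈ propagating k Λ α,
    1 / betaN k Λ α n *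
      cexp (I * (alphaN Λ α n : ℂ) * ((y 0 - z 0 : ℝ) : ℂ) +
        I * betaN k Λ α n * ((y 1 - z 1 : ℝ) : ℂ))

/-- The one-sided correlation integrand `x ↦ (∂/∂x₂ conj G(x,y)) G(x,z)`. -/
def corrLeft (k Λ α : ℝ) (y z x : Plane) : ℂ :=
  vertDeriv (fun w => conj (green k Λ α w y)) x * green k Λ α x z

/-- The one-sided correlation integrand `x ↦ (∂/∂x₂ G(x,z)) conj G(x,y)`. -/
def corrRight (k Λ α : ℝ) (y z x : Plane) : ℂ :=
  vertDeriv (fun w => green k Λ α w z) x * conj (green k Λ α x y)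

/-- `R^U_α(y,z;h)`, the error in approximating the one-sided correlation on `Γ_h` by
`-F^U_α(y,z)/2`. -/
def remainderU (k Λ α h : ℝ) (y z : Plane) : ℂ :=
  segIntegral Λ h (corrLeft k Λ α y z) - (-(1 / 2) * pointSpreadU k Λ α y z)

end QuasiPeriodic

end

open QuasiPeriodic

noncomputable section

namespace QuasiPeriodic

open MeasureTheory Filter Topology Set

/-! ### Bessel's equation of order zero as a first order system -/

/-! The core is the spectral representation of the Green's function above its source: if `y 1 < x
1`, then `green` equals `I / (2 * Λ)` times the absolutely convergent sum over `n` of `1/βₙ * exp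
(iαₙ(x₁ - y₁) + iβₙ(x₂ - y₂))` (`green_eq_tsum`). On `Γ_h` this is a Fourier series in `x₁`.
Orthogonality on one period (`integral_tsum_mul_tsum`) turns each correlation integral into a single
sum over modes.

For a propagating mode `βₙ` is real. Conjugation then cancels the dependence on `h`, and the two
one-sided correlations are opposite, each giving half of the point spread function up to sign. For
an evanescent mode `βₙ` is purely imaginary. The two correlations then agree, so they cancel in (a),
and each is of size `exp (-Im βₙ (2h - y₂ - z₂))`, which is the remainder in (b). Away from Wood
anomalies `|βₙ|` is bounded below and `Im βₙ` grows linearly in `|n|`, so these terms and their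
gradients are summable with a factor `1/h` to spare (`leftTerm_eq`, `leftTerm_sub_rightTerm`,
`norm_remainderTerm_le`).

The spectral representation starts from power series. `hankel_eq_integral` writes `π H₀` as an
integral over an interval of angles plus an integral over a half line: both sides solve Bessel's
equation, and their difference vanishes at the origin together with its flux. Rotating the direction
(`planeWave_eq_hankel`) and substituting `ξ = k sin θ` and `ξ = ±k cosh u` gives the plane wave
integral of `H₀` over the real line (`integral_planeMode`). The Green's function is thus a symmetric
sum of Fourier coefficients of a function that is integrable but singular at `±k`.
`tendsto_sum_integral_mul_negChar` is a Dini-type Poisson summation needing regularity only near the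
sample points, and the absence of Wood anomalies keeps these off the singularities. -/

/-- An everywhere convergent power series has Euler derivative `∑ m aₘ qᵐ`. -/
theorem hasDerivAt_tsum_mul_pow {a : ℕ → ℝ} (ha : ∀ x : ℝ, Summable fun m => a m * x ^ m)
    {q : ℝ} (hq : 0 < q) :
    HasDerivAt (fun x => ∑' m, a m * x ^ m) ((∑' m, m * a m * q ^ m) / q) q := by
  have hR : 0 < 2 * q := by positivity
  -- On `(0, 2q)` the derivatives are dominated by the series at `4q`, because `m ≤ 2 ^ m`.
  have hu : Summable fun m : ℕ => |a m * (4 * q) ^ m| / q := (ha _).abs.div_const q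
  have key := hasDerivAt_tsum_of_isPreconnected (g := fun m x => a m * x ^ m)
    (g' := fun m x => a m * (m * x ^ (m - 1))) (t := Ioo 0 (2 * q)) (y₀ := q) (y := q) hu
    isOpen_Ioo isPreconnected_Ioo (fun m x _ => (hasDerivAt_pow m x).const_mul (a m)) ?_
    ⟨hq, by linarith⟩ (ha q) ⟨hq, by linarith⟩
  · refine key.congr_deriv ?_
    rw [← tsum_div_const]
    refine tsum_congr fun m => ?_
    rcases m with _ | m
    · simp
    · rw [Nat.add_sub_cancel, pow_succ]; field_simp
  · intro m x hx
    rcases m with _ | m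
    · simp; positivity
    · rw [norm_mul, norm_mul, Real.norm_eq_abs, Nat.add_sub_cancel, abs_mul, norm_pow,
        abs_of_nonneg (by positivity : (0 : ℝ) ≤ (4 * q) ^ (m + 1)), mul_div_assoc]
      gcongr
      have h1 : ((m + 1 : ℕ) : ℝ) ≤ 2 ^ (m + 1) := by exact_mod_cast (Nat.lt_two_pow_self).le
      have h2 : ‖x‖ ≤ 2 * q := by rw [Real.norm_eq_abs, abs_of_pos hx.1]; exact hx.2.le
      have h3 : ‖((m + 1 : ℕ) : ℝ)‖ = ((m + 1 : ℕ) : ℝ) := Real.norm_of_nonneg (Nat.cast_nonneg _)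
      rw [h3]
      calc ((m + 1 : ℕ) : ℝ) * ‖x‖ ^ m ≤ 2 ^ (m + 1) * (2 * q) ^ m := by gcongr
        _ ≤ 2 ^ (m + 1) * (2 * (2 * q) ^ m) := by gcongr; nlinarith [pow_pos hR m]
        _ = (4 * q) ^ (m + 1) / q := by
          rw [show 4 * q = 2 * (2 * q) by ring, mul_pow 2 (2 * q), pow_succ (2 * q)]
          field_simp

theorem tendsto_tsum_mul_pow_zero {a : ℕ → ℝ}
    (ha : ∀ x : ℝ, Summable fun m => a m * x ^ m) :
    Tendsto (fun x => ∑' m, a m * x ^ m) (𝓝 0) (𝓝 (a 0)) := by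
  have h : ContinuousOn (fun x : ℝ => ∑' m, a m * x ^ m) (Icc (-1) 1) := by
    refine continuousOn_tsum (u := fun m => |a m * 1 ^ m|) (fun m => by fun_prop) (ha 1).abs ?_
    intro m x hx
    rw [norm_mul, norm_pow, abs_mul, abs_pow, abs_one, Real.norm_eq_abs, Real.norm_eq_abs]
    gcongr
    exact abs_le.2 hx
  have h0 := (h.continuousAt (Icc_mem_nhds (by norm_num : (-1 : ℝ) < 0) one_pos)).tendsto
  rw [tsum_eq_single 0 (by intro m hm; simp [hm])] at h0
  simpa using h0

theorem summable_nat_mul_mul_pow {a : ℕ → ℝ} (ha : ∀ x : ℝ, Summable fun m => a m * x ^ m)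
    (x : ℝ) : Summable fun m : ℕ => m * a m * x ^ m := by
  refine Summable.of_norm_bounded (ha (2 * x)).abs fun m => ?_
  have h1 : (m : ℝ) ≤ 2 ^ m := by exact_mod_cast (Nat.lt_two_pow_self).le
  rw [norm_mul, norm_mul, Real.norm_eq_abs, Real.norm_eq_abs, Real.norm_eq_abs, abs_mul,
    mul_pow, abs_mul, abs_of_nonneg (Nat.cast_nonneg m),
    abs_of_nonneg (by positivity : (0 : ℝ) ≤ 2 ^ m)]
  calc m * |a m| * |x ^ m| ≤ 2 ^ m * |a m| * |x ^ m| := by gcongr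
    _ = _ := by ring

theorem summable_mul_pow_of_le {a : ℕ → ℝ} {C : ℝ} (h : ∀ m, |a m| ≤ C / (m.factorial : ℝ))
    (x : ℝ) : Summable fun m => a m * x ^ m := by
  refine Summable.of_norm_bounded (((Real.summable_pow_div_factorial |x|).mul_left C)) ?_
  intro m
  rw [norm_mul, norm_pow, Real.norm_eq_abs, Real.norm_eq_abs]
  calc _ ≤ C / (m.factorial : ℝ) * |x| ^ m := by gcongr; exact h m
    _ = _ := by ring

/-- The coefficients of `J₀` as a power series in `r² / 4`. -/
def coeffJ (m : ℕ) : ℝ := (-1) ^ m / (m.factorial : ℝ) ^ 2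

/-- The coefficients of the power series part of `Y₀`. -/
def coeffY (m : ℕ) : ℝ := harmonic m * coeffJ m

theorem abs_coeffJ (m : ℕ) : |coeffJ m| = 1 / (m.factorial : ℝ) ^ 2 := by
  simp [coeffJ, abs_div]

/-- This recursion is Bessel's equation on coefficients: with `q = r²/4` and `θ = q d/dq`, it says
`θ²J = -qJ`. -/
theorem coeffJ_succ (m : ℕ) : ((m : ℝ) + 1) ^ 2 * coeffJ (m + 1) = -coeffJ m := by
  have : (m.factorial : ℝ) ≠ 0 := by positivity
  rw [coeffJ, coeffJ, Nat.factorial_succ]; push_cast; rw [pow_succ]; field_simp; ring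

theorem nat_le_factorial (m : ℕ) : (m : ℝ) ≤ m.factorial := by
  exact_mod_cast Nat.self_le_factorial m

theorem harmonic_nonneg (m : ℕ) : (0 : ℚ) ≤ harmonic m := by
  unfold harmonic; positivity

theorem harmonic_le (m : ℕ) : ((harmonic m : ℚ) : ℝ) ≤ m := by
  induction m with
  | zero => simp
  | succ m ih =>
    rw [harmonic_succ]; push_cast
    have : ((m : ℝ) + 1)⁻¹ ≤ 1 := inv_le_one_of_one_le₀ (by linarith [Nat.cast_nonneg (α := ℝ) m])
    linarith

theorem abs_mul_coeffJ_le {c : ℝ} (m : ℕ) (hc : |c| ≤ m + 1) :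
    |c * coeffJ m| ≤ 2 / m.factorial := by
  rw [abs_mul, abs_coeffJ]
  have h0 : (1 : ℝ) ≤ m.factorial := by exact_mod_cast Nat.succ_le_of_lt m.factorial_pos
  have h1 := nat_le_factorial m
  rw [mul_one_div, div_le_div_iff₀ (by positivity) (by positivity)]
  nlinarith

theorem summable_coeffJ (x : ℝ) : Summable fun m => coeffJ m * x ^ m :=
  summable_mul_pow_of_le (C := 2) (fun m => by
    simpa using abs_mul_coeffJ_le (c := 1) m (by simp)) x

theorem summable_coeffY (x : ℝ) : Summable fun m => coeffY m * x ^ m :=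
  summable_mul_pow_of_le (C := 2) (fun m => abs_mul_coeffJ_le m (by
    rw [abs_of_nonneg (by exact_mod_cast harmonic_nonneg m)]; linarith [harmonic_le m])) x

/-- `J₀` as a function of `q = r² / 4`. -/
def seriesJ (q : ℝ) : ℝ := ∑' m, coeffJ m * q ^ m

/-- The Euler derivative `q d/dq` of `seriesJ`. -/
def eulerJ (q : ℝ) : ℝ := ∑' m : ℕ, m * coeffJ m * q ^ m

/-- The power series part of `Y₀` as a function of `q = r² / 4`. -/
def seriesY (q : ℝ) : ℝ := ∑' m, coeffY m * q ^ m

/-- The Euler derivative `q d/dq` of `seriesY`. -/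
def eulerY (q : ℝ) : ℝ := ∑' m : ℕ, m * coeffY m * q ^ m

theorem hasDerivAt_seriesJ {q : ℝ} (hq : 0 < q) : HasDerivAt seriesJ (eulerJ q / q) q :=
  hasDerivAt_tsum_mul_pow summable_coeffJ hq

theorem hasDerivAt_seriesY {q : ℝ} (hq : 0 < q) : HasDerivAt seriesY (eulerY q / q) q :=
  hasDerivAt_tsum_mul_pow summable_coeffY hq

theorem hasDerivAt_eulerJ {q : ℝ} (hq : 0 < q) : HasDerivAt eulerJ (-seriesJ q) q := by
  have hs := summable_nat_mul_mul_pow summable_coeffJ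
  refine (hasDerivAt_tsum_mul_pow hs hq).congr_deriv ?_
  rw [(summable_nat_mul_mul_pow hs q).tsum_eq_zero_add, seriesJ, ← tsum_neg]
  simp only [Nat.cast_zero, zero_mul, zero_add, ← tsum_div_const]
  refine tsum_congr fun m => ?_
  rw [neg_mul_eq_neg_mul, ← coeffJ_succ, pow_succ]; push_cast; field_simp

/-- The harmonic increment `1/(m+1)` adds `eulerJ q / q` to the recursion for `J₀`. In
`hasDerivAt_besselY0Flux` this term cancels against those from differentiating the logarithm. -/
theorem hasDerivAt_eulerY {q : ℝ} (hq : 0 < q) :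
    HasDerivAt eulerY (-seriesY q + eulerJ q / q) q := by
  have hs := summable_nat_mul_mul_pow summable_coeffY
  have hJ := summable_nat_mul_mul_pow summable_coeffJ q
  refine (hasDerivAt_tsum_mul_pow hs hq).congr_deriv ?_
  rw [(summable_nat_mul_mul_pow hs q).tsum_eq_zero_add, seriesY, ← tsum_neg, eulerJ,
    hJ.tsum_eq_zero_add]
  simp only [Nat.cast_zero, zero_mul, zero_add, ← tsum_div_const]
  rw [← Summable.tsum_add (summable_coeffY q).neg
    (((summable_nat_add_iff 1).2 hJ).div_const q)]
  refine tsum_congr fun m => ?_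
  have h := coeffJ_succ m
  have hm : (m : ℝ) + 1 ≠ 0 := by positivity
  rw [coeffY, coeffY, harmonic_succ, neg_mul_eq_neg_mul, neg_mul_eq_mul_neg, ← h, pow_succ]
  push_cast
  field_simp

theorem besselJ0_eq (r : ℝ) : besselJ0 r = seriesJ (r ^ 2 / 4) :=
  tsum_congr fun m => by rw [coeffJ]; ring

theorem besselY0_eq (r : ℝ) : besselY0 r = 2 / Real.pi *
    ((Real.log (r / 2) + Real.eulerMascheroniConstant) * seriesJ (r ^ 2 / 4) -
      seriesY (r ^ 2 / 4)) := by
  have h : ∑' m : ℕ, (-1) ^ m * (harmonic m : ℝ) * (r ^ 2 / 4) ^ m / (m.factorial : ℝ) ^ 2 =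
      seriesY (r ^ 2 / 4) := tsum_congr fun m => by rw [coeffY, coeffJ]; ring
  rw [besselY0, besselJ0_eq, h]; ring

theorem hasDerivAt_sq_div_four (r : ℝ) : HasDerivAt (fun r : ℝ => r ^ 2 / 4) (r / 2) r :=
  ((hasDerivAt_pow 2 r).div_const 4).congr_deriv (by push_cast; ring)

/-- `r J₀'(r)`. -/
def besselJ0Flux (r : ℝ) : ℝ := 2 * eulerJ (r ^ 2 / 4)

/-- `r Y₀'(r)`. -/
def besselY0Flux (r : ℝ) : ℝ := 2 / Real.pi * (seriesJ (r ^ 2 / 4) +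
  2 * (Real.log (r / 2) + Real.eulerMascheroniConstant) * eulerJ (r ^ 2 / 4) -
    2 * eulerY (r ^ 2 / 4))

theorem hasDerivAt_besselJ0 {r : ℝ} (hr : 0 < r) :
    HasDerivAt besselJ0 (besselJ0Flux r / r) r := by
  rw [funext besselJ0_eq]
  refine ((hasDerivAt_seriesJ (by positivity)).comp r (hasDerivAt_sq_div_four r)).congr_deriv ?_
  rw [besselJ0Flux]; field_simp; ring

theorem hasDerivAt_besselJ0Flux {r : ℝ} (hr : 0 < r) :
    HasDerivAt besselJ0Flux (-(r * besselJ0 r)) r := by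
  rw [besselJ0_eq]
  refine (((hasDerivAt_eulerJ (by positivity)).comp r
    (hasDerivAt_sq_div_four r)).const_mul 2).congr_deriv ?_
  ring

theorem hasDerivAt_log_half {r : ℝ} (hr : 0 < r) :
    HasDerivAt (fun r => Real.log (r / 2) + Real.eulerMascheroniConstant) (1 / r) r :=
  ((((hasDerivAt_id r).div_const 2).log (by simp; positivity)).add_const _).congr_deriv
    (by simp; field_simp)

theorem hasDerivAt_besselY0 {r : ℝ} (hr : 0 < r) :
    HasDerivAt besselY0 (besselY0Flux r / r) r := by
  rw [funext besselY0_eq]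
  have hq : 0 < r ^ 2 / 4 := by positivity
  have hd := hasDerivAt_sq_div_four r
  refine ((((hasDerivAt_log_half hr).mul ((hasDerivAt_seriesJ hq).comp r hd)).sub
    ((hasDerivAt_seriesY hq).comp r hd)).const_mul (2 / Real.pi)).congr_deriv ?_
  simp only [besselY0Flux, Function.comp]; field_simp; ring

theorem hasDerivAt_besselY0Flux {r : ℝ} (hr : 0 < r) :
    HasDerivAt besselY0Flux (-(r * besselY0 r)) r := by
  rw [besselY0_eq]
  have hq : 0 < r ^ 2 / 4 := by positivity
  have hd := hasDerivAt_sq_div_four r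
  refine (((((hasDerivAt_seriesJ hq).comp r hd).add
    (((hasDerivAt_log_half hr).const_mul 2).mul ((hasDerivAt_eulerJ hq).comp r hd))).sub
    (((hasDerivAt_eulerY hq).comp r hd).const_mul 2)).const_mul (2 / Real.pi)).congr_deriv ?_
  simp only [Function.comp]; field_simp; ring

/-- A solution of Bessel's equation of order zero on `(0, ∞)`, written as a first order system for
`D` and `p = r D'`, vanishes if `D` and `p` tend to zero at the origin. -/
theorem bessel_system_unique {D p : ℝ → ℝ} (hD : ∀ r, 0 < r → HasDerivAt D (p r / r) r)
    (hp : ∀ r, 0 < r → HasDerivAt p (-(r * D r)) r) (hD0 : Tendsto D (𝓝[>] 0) (𝓝 0))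
    (hp0 : Tendsto p (𝓝[>] 0) (𝓝 0)) {r : ℝ} (hr : 0 < r) : D r = 0 := by
  -- The energy `D² + D'²` decreases because the first order term of Bessel's equation is a damping.
  -- It is therefore enough to make it small near the origin.
  have hEd : ∀ r, 0 < r → HasDerivAt (fun r => D r ^ 2 + (p r / r) ^ 2)
      (-(2 * p r ^ 2 / r ^ 3)) r := by
    intro r hr
    refine (((hD r hr).pow 2).add (((hp r hr).div (hasDerivAt_id' r) hr.ne').pow 2)).congr_deriv ?_
    simp only [Pi.div_apply, Nat.reduceSub, pow_one, Nat.cast_ofNat]; field_simp; ring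
  have hEanti : AntitoneOn (fun r => D r ^ 2 + (p r / r) ^ 2) (Ioi 0) := by
    refine antitoneOn_of_deriv_nonpos (convex_Ioi 0)
      (fun x hx => (hEd x hx).continuousAt.continuousWithinAt)
      (fun x hx => (hEd x (by simpa using hx)).differentiableAt.differentiableWithinAt) ?_
    intro x hx
    rw [interior_Ioi] at hx
    have hx' : 0 < x := hx
    rw [(hEd x hx).deriv]
    exact neg_nonpos.2 (by positivity)
  have hle : ∀ ε > 0, D r ^ 2 + (p r / r) ^ 2 ≤ ε := by
    intro ε hε
    have h1 : ∀ᶠ x in 𝓝[>] (0 : ℝ), D x ^ 2 < ε := by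
      have := hD0.pow 2
      rw [zero_pow two_ne_zero] at this
      exact this.eventually_lt_const hε
    obtain ⟨η, hη, hηε⟩ := mem_nhdsGT_iff_exists_Ioo_subset.1 h1
    have hη : 0 < η := hη
    -- That `p = rD'` tends to zero does not yet control `D'`. The function `r²D² + p² - εr²` tends
    -- to zero at the origin and decreases wherever `D² < ε`, so it is nonpositive there, which
    -- bounds the energy by `ε`.
    have hVd : ∀ x, 0 < x → HasDerivAt (fun x => x ^ 2 * D x ^ 2 + p x ^ 2 - ε * x ^ 2)
        (2 * x * (D x ^ 2 - ε)) x := by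
      intro x hx
      refine ((((hasDerivAt_pow 2 x).mul ((hD x hx).pow 2)).add ((hp x hx).pow 2)).sub
        ((hasDerivAt_pow 2 x).const_mul ε)).congr_deriv ?_
      push_cast; simp only [Pi.pow_apply]; field_simp; ring
    have hVanti : AntitoneOn (fun x => x ^ 2 * D x ^ 2 + p x ^ 2 - ε * x ^ 2) (Ioo 0 η) := by
      refine antitoneOn_of_deriv_nonpos (convex_Ioo 0 η)
        (fun x hx => (hVd x hx.1).continuousAt.continuousWithinAt)
        (fun x hx => (hVd x (by rw [interior_Ioo] at hx; exact
          hx.1)).differentiableAt.differentiableWithinAt) ?_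
      intro x hx
      rw [interior_Ioo] at hx
      have hx' : D x ^ 2 < ε := hηε hx
      rw [(hVd x hx.1).deriv]
      nlinarith [hx.1]
    have hV0 : Tendsto (fun x => x ^ 2 * D x ^ 2 + p x ^ 2 - ε * x ^ 2) (𝓝[>] 0) (𝓝 0) := by
      have hx : Tendsto (fun x : ℝ => x) (𝓝[>] 0) (𝓝 0) := nhdsWithin_le_nhds
      simpa using (((hx.pow 2).mul (hD0.pow 2)).add (hp0.pow 2)).sub ((hx.pow 2).const_mul ε)
    set ρ := min (η / 2) r with hρ
    have hρ0 : 0 < ρ := by positivity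
    have hρη : ρ < η := (min_le_left _ _).trans_lt (by linarith)
    have hV : ρ ^ 2 * D ρ ^ 2 + p ρ ^ 2 - ε * ρ ^ 2 ≤ 0 := by
      refine ge_of_tendsto hV0 ?_
      filter_upwards [Ioo_mem_nhdsGT hρ0] with x hx
      exact hVanti ⟨hx.1, hx.2.trans hρη⟩ ⟨hρ0, hρη⟩ hx.2.le
    refine (hEanti hρ0 hr (min_le_right _ _)).trans ?_
    have : (D ρ ^ 2 + (p ρ / ρ) ^ 2) * ρ ^ 2 ≤ ε * ρ ^ 2 := by
      rw [add_mul, div_pow, div_mul_cancel₀ _ (by positivity)]; linarith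
    exact le_of_mul_le_mul_right this (by positivity)
  have h0 : D r ^ 2 + (p r / r) ^ 2 ≤ 0 := le_of_forall_pos_le_add (by simpa using hle)
  have : D r ^ 2 ≤ 0 := by nlinarith [sq_nonneg (p r / r)]
  exact pow_eq_zero_iff two_ne_zero |>.1 (le_antisymm this (sq_nonneg _))

theorem bessel_system_unique_complex {D p : ℝ → ℂ}
    (hD : ∀ r, 0 < r → HasDerivAt D (p r / r) r)
    (hp : ∀ r, 0 < r → HasDerivAt p (-(r * D r)) r) (hD0 : Tendsto D (𝓝[>] 0) (𝓝 0))
    (hp0 : Tendsto p (𝓝[>] 0) (𝓝 0)) {r : ℝ} (hr : 0 < r) : D r = 0 := by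
  refine Complex.ext ?_ ?_
  · refine bessel_system_unique (D := fun r => (D r).re) (p := fun r => (p r).re) ?_ ?_ ?_ ?_ hr
    · exact fun x hx =>
        (reCLM.hasFDerivAt.comp_hasDerivAt x (hD x hx)).congr_deriv (by simp)
    · exact fun x hx =>
        (reCLM.hasFDerivAt.comp_hasDerivAt x (hp x hx)).congr_deriv (by simp)
    · exact (continuous_re.tendsto 0).comp hD0
    · exact (continuous_re.tendsto 0).comp hp0
  · refine bessel_system_unique (D := fun r => (D r).im) (p := fun r => (p r).im) ?_ ?_ ?_ ?_ hr
    · exact fun x hx =>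
        (imCLM.hasFDerivAt.comp_hasDerivAt x (hD x hx)).congr_deriv (by simp)
    · exact fun x hx =>
        (imCLM.hasFDerivAt.comp_hasDerivAt x (hp x hx)).congr_deriv (by simp)
    · exact (continuous_im.tendsto 0).comp hD0
    · exact (continuous_im.tendsto 0).comp hp0

/-! ### Exponential integrals of `sinh` -/

theorem cosh_le_one_add_sinh {u : ℝ} (hu : 0 ≤ u) : Real.cosh u ≤ 1 + Real.sinh u := by
  have h1 : Real.exp (-u) ≤ 1 := Real.exp_le_one_iff.2 (by linarith)
  have h2 := Real.cosh_sub_sinh u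
  linarith

theorem tendsto_exp_neg_mul_sinh {c : ℝ} (hc : 0 < c) :
    Tendsto (fun u => Real.exp (-(c * Real.sinh u))) atTop (𝓝 0) := by
  refine Real.tendsto_exp_neg_atTop_nhds_zero.comp ?_
  refine (tendsto_atTop_mono' _ ?_ tendsto_id).const_mul_atTop hc
  filter_upwards [eventually_ge_atTop 0] with u hu using Real.self_le_sinh_iff.2 hu

theorem hasDerivAt_exp_neg_mul_sinh (c u : ℝ) :
    HasDerivAt (fun u => Real.exp (-(c * Real.sinh u)))
      (-(c * Real.cosh u * Real.exp (-(c * Real.sinh u)))) u :=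
  (((Real.hasDerivAt_sinh u).const_mul c).fun_neg.exp).congr_deriv (by ring)

theorem integrableOn_cosh_mul_exp {c : ℝ} (hc : 0 < c) :
    IntegrableOn (fun u => Real.cosh u * Real.exp (-(c * Real.sinh u))) (Ioi 0) := by
  have h := integrableOn_Ioi_deriv_of_nonneg' (a := 0) (l := -0)
    (fun x _ => (hasDerivAt_exp_neg_mul_sinh c x).neg)
    (fun x _ => by have := Real.cosh_pos x; rw [neg_neg]; positivity)
    (tendsto_exp_neg_mul_sinh hc).neg
  refine (h.const_mul c⁻¹).congr (ae_of_all _ fun u => ?_)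
  simp only [neg_neg]; field_simp

theorem integral_cosh_mul_exp {c : ℝ} (hc : 0 < c) :
    ∫ u in Ioi (0 : ℝ), c * Real.cosh u * Real.exp (-(c * Real.sinh u)) = 1 := by
  have h := integral_Ioi_of_hasDerivAt_of_tendsto' (a := 0)
    (fun x _ => (hasDerivAt_exp_neg_mul_sinh c x).neg)
    (by
      simp only [neg_neg, mul_assoc]
      exact (integrableOn_cosh_mul_exp hc).const_mul c)
    (tendsto_exp_neg_mul_sinh hc).neg
  simpa using h

/-- Half of the decay rate pays for a linear factor. This serves both for `x = sinh u` and for `x =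
Im βₙ`. -/
theorem one_add_mul_exp_le {c x : ℝ} (hc : 0 < c) (hx : 0 ≤ x) :
    (1 + x) * Real.exp (-(c * x)) ≤ (1 + 2 / c) * Real.exp (-(c / 2 * x)) := by
  have h1 : 1 + x ≤ (1 + 2 / c) * Real.exp (c / 2 * x) := by
    calc 1 + x ≤ (1 + 2 / c) * (c / 2 * x + 1) := by
          have : (1 + 2 / c) * (c / 2 * x + 1) = 1 + x + (2 / c + c / 2 * x) := by field_simp; ring
          rw [this]; have : 0 ≤ 2 / c + c / 2 * x := by positivity
          linarith
      _ ≤ _ := by gcongr; exact Real.add_one_le_exp _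
  calc _ ≤ (1 + 2 / c) * Real.exp (c / 2 * x) * Real.exp (-(c * x)) := by gcongr
    _ = _ := by rw [mul_assoc, ← Real.exp_add]; ring_nf

theorem cosh_sq_mul_exp_le {c u : ℝ} (hc : 0 < c) (hu : 0 ≤ u) :
    Real.cosh u ^ 2 * Real.exp (-(c * Real.sinh u)) ≤
      (1 + 2 / c) * (Real.cosh u * Real.exp (-(c / 2 * Real.sinh u))) := by
  have h1 := cosh_le_one_add_sinh hu
  have h2 := one_add_mul_exp_le hc (Real.sinh_nonneg_iff.2 hu)
  have h3 := Real.cosh_pos u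
  calc _ = Real.cosh u * (Real.cosh u * Real.exp (-(c * Real.sinh u))) := by ring
    _ ≤ Real.cosh u * ((1 + Real.sinh u) * Real.exp (-(c * Real.sinh u))) := by gcongr
    _ ≤ Real.cosh u * ((1 + 2 / c) * Real.exp (-(c / 2 * Real.sinh u))) := by gcongr
    _ = _ := by ring

theorem integrableOn_cosh_sq_mul_exp {c : ℝ} (hc : 0 < c) :
    IntegrableOn (fun u => Real.cosh u ^ 2 * Real.exp (-(c * Real.sinh u))) (Ioi 0) := by
  refine ((integrableOn_cosh_mul_exp (half_pos hc)).const_mul (1 + 2 / c)).mono'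
    (by fun_prop) ?_
  filter_upwards [ae_restrict_mem measurableSet_Ioi] with u hu
  rw [Real.norm_of_nonneg (by positivity)]
  exact cosh_sq_mul_exp_le hc (le_of_lt hu)

theorem integrableOn_mul_exp_of_le {f : ℝ → ℝ} (hf : Continuous f) {c : ℝ} (hc : 0 < c)
    (hle : ∀ u, 0 < u → |f u| ≤ Real.cosh u ^ 2) :
    IntegrableOn (fun u => f u * Real.exp (-(c * Real.sinh u))) (Ioi 0) := by
  refine (integrableOn_cosh_sq_mul_exp hc).mono' (by fun_prop) ?_
  filter_upwards [ae_restrict_mem measurableSet_Ioi] with u hu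
  rw [norm_mul, Real.norm_eq_abs, Real.norm_of_nonneg (Real.exp_pos _).le]
  gcongr
  exact hle u hu

theorem abs_sinh_le_cosh (u : ℝ) : |Real.sinh u| ≤ Real.cosh u := by
  refine abs_le_of_sq_le_sq ?_ (Real.cosh_pos u).le
  rw [Real.sinh_sq]; linarith

theorem hasDerivAt_integral_mul_exp_sinh {f : ℝ → ℝ} (hf : Continuous f)
    (hle : ∀ u, 0 < u → |f u| ≤ Real.cosh u) {r : ℝ} (hr : 0 < r) :
    HasDerivAt (fun r => ∫ u in Ioi (0 : ℝ), f u * Real.exp (-(r * Real.sinh u)))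
      (-∫ u in Ioi (0 : ℝ), Real.sinh u * f u * Real.exp (-(r * Real.sinh u))) r := by
  have h := hasDerivAt_integral_of_dominated_loc_of_deriv_le (μ := volume.restrict (Ioi 0))
    (x₀ := r) (s := Ioi (r / 2)) (F := fun r u => f u * Real.exp (-(r * Real.sinh u)))
    (F' := fun r u => -(Real.sinh u * f u * Real.exp (-(r * Real.sinh u))))
    (bound := fun u => Real.cosh u ^ 2 * Real.exp (-(r / 2 * Real.sinh u)))
    (Ioi_mem_nhds (by linarith)) (Eventually.of_forall fun x => by fun_prop)
    (integrableOn_mul_exp_of_le hf hr fun u hu => (hle u hu).trans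
      (by nlinarith [Real.one_le_cosh u])) (by fun_prop) ?_
    (integrableOn_cosh_sq_mul_exp (half_pos hr)) ?_
  · simpa only [integral_neg] using h.2
  · filter_upwards [ae_restrict_mem measurableSet_Ioi] with u hu x hx
    have hx : r / 2 < x := hx
    have h0 := Real.sinh_nonneg_iff.2 (le_of_lt hu)
    rw [norm_neg, norm_mul, norm_mul, Real.norm_eq_abs, Real.norm_eq_abs,
      Real.norm_of_nonneg (Real.exp_pos _).le, sq]
    gcongr
    · exact abs_sinh_le_cosh u
    · exact hle u hu
  · refine ae_of_all _ fun u x _ => ?_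
    refine ((((hasDerivAt_id' x).mul_const (Real.sinh u)).fun_neg.exp).const_mul (f
      u)).congr_deriv ?_
    ring

/-- `∫₀^∞ e^{-r sinh u} du`. -/
def expSinhIntegral (r : ℝ) : ℝ := ∫ u in Ioi (0 : ℝ), Real.exp (-(r * Real.sinh u))

/-- `r` times the derivative of `expSinhIntegral`. -/
def expSinhFlux (r : ℝ) : ℝ :=
  r * -∫ u in Ioi (0 : ℝ), Real.sinh u * Real.exp (-(r * Real.sinh u))

theorem hasDerivAt_expSinhIntegral {r : ℝ} (hr : 0 < r) :
    HasDerivAt expSinhIntegral (expSinhFlux r / r) r := by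
  have h := hasDerivAt_integral_mul_exp_sinh (f := fun _ => 1) continuous_const
    (fun u _ => by simp) hr
  simp only [one_mul, mul_one] at h
  refine h.congr_deriv ?_
  rw [expSinhFlux, mul_div_cancel_left₀ _ hr.ne']

/-- Integrating the `u`-derivative of `cosh u * exp (-r sinh u)` leaves a boundary value at `u = 0`,
so Bessel's equation holds with source `1`. Multiplied by `2i`, it matches the source in
`hasDerivAt_expCosFlux`. -/
theorem hasDerivAt_expSinhFlux {r : ℝ} (hr : 0 < r) :
    HasDerivAt expSinhFlux (1 - r * expSinhIntegral r) r := by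
  have h := (hasDerivAt_id' r).mul
    (hasDerivAt_integral_mul_exp_sinh Real.continuous_sinh (fun u _ => abs_sinh_le_cosh u) hr).neg
  refine h.congr_deriv ?_
  have hs := integrableOn_mul_exp_of_le Real.continuous_sinh hr
    (fun u _ => (abs_sinh_le_cosh u).trans (by nlinarith [Real.one_le_cosh u]))
  have hss := integrableOn_mul_exp_of_le (f := fun u => Real.sinh u * Real.sinh u)
    (by fun_prop) hr (fun u _ => by rw [abs_mul_self, ← sq, Real.sinh_sq]; linarith)
  have h1 := integrableOn_mul_exp_of_le (f := fun _ => 1) continuous_const hr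
    (fun u _ => by rw [abs_one]; nlinarith [Real.one_le_cosh u])
  have hcs := (integrableOn_cosh_sq_mul_exp hr).const_mul r
  have hd : ∀ u : ℝ, HasDerivAt (fun u => Real.cosh u * Real.exp (-(r * Real.sinh u)))
      (Real.sinh u * Real.exp (-(r * Real.sinh u)) -
        r * (Real.cosh u ^ 2 * Real.exp (-(r * Real.sinh u)))) u := fun u =>
    ((Real.hasDerivAt_cosh u).mul (hasDerivAt_exp_neg_mul_sinh r u)).congr_deriv (by ring)
  have hlim : Tendsto (fun u => Real.cosh u * Real.exp (-(r * Real.sinh u))) atTop (𝓝 0) := by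
    refine squeeze_zero' (g := fun u => (1 + 2 / r) * Real.exp (-(r / 2 * Real.sinh u)))
      (Eventually.of_forall fun u => by positivity) ?_
      (by simpa using (tendsto_exp_neg_mul_sinh (half_pos hr)).const_mul (1 + 2 / r))
    filter_upwards [eventually_ge_atTop 0] with u hu
    refine le_trans ?_ (one_add_mul_exp_le hr (Real.sinh_nonneg_iff.2 hu))
    gcongr
    exact cosh_le_one_add_sinh hu
  have hint := integral_Ioi_of_hasDerivAt_of_tendsto' (a := 0) (fun x _ => hd x) (hs.sub hcs) hlim
  rw [integral_sub hs hcs, integral_const_mul] at hint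
  simp only [Real.cosh_sq', add_mul, Real.cosh_zero, Real.sinh_zero, mul_zero, neg_zero,
    Real.exp_zero, mul_one] at hint
  have hss' : IntegrableOn (fun u => Real.sinh u ^ 2 * Real.exp (-(r * Real.sinh u))) (Ioi 0) := by
    simpa only [sq] using hss
  rw [integral_add h1 hss'] at hint
  simp only [one_mul, ← sq, Pi.neg_apply] at hint ⊢
  rw [expSinhIntegral]
  linarith

/-- Replacing `sinh` by `cosh` in front of the exponential makes the integral exact, with value
`-1`. The error is `r ∫ exp (-u) exp (-r sinh u) du`, which lies in `[0, r]`. -/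
theorem tendsto_expSinhFlux : Tendsto expSinhFlux (𝓝[>] 0) (𝓝 (-1)) := by
  have hle : ∀ r : ℝ, 0 < r → -1 ≤ expSinhFlux r ∧ expSinhFlux r ≤ -1 + r := by
    intro r hr
    have hs := integrableOn_mul_exp_of_le Real.continuous_sinh hr
      (fun u _ => (abs_sinh_le_cosh u).trans (by nlinarith [Real.one_le_cosh u]))
    have hc := integrableOn_cosh_mul_exp hr
    have h1 := integral_cosh_mul_exp hr
    simp only [mul_assoc] at h1
    rw [integral_const_mul] at h1
    have h2 : ∫ u in Ioi (0 : ℝ), Real.exp (-u) = 1 := by simpa using integral_exp_neg_Ioi 0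
    have h3 : expSinhFlux r + 1 = r * ∫ u in Ioi (0 : ℝ),
        (Real.cosh u * Real.exp (-(r * Real.sinh u)) -
          Real.sinh u * Real.exp (-(r * Real.sinh u))) := by
      rw [integral_sub hc hs, expSinhFlux, ← h1]; ring
    have h4 : ∀ u : ℝ, Real.cosh u * Real.exp (-(r * Real.sinh u)) -
        Real.sinh u * Real.exp (-(r * Real.sinh u)) =
          Real.exp (-u) * Real.exp (-(r * Real.sinh u)) := fun u => by
      rw [← sub_mul, Real.cosh_sub_sinh]
    have h5 : ∫ u in Ioi (0 : ℝ), (Real.cosh u * Real.exp (-(r * Real.sinh u)) -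
          Real.sinh u * Real.exp (-(r * Real.sinh u))) ≤ ∫ u in Ioi (0 : ℝ), Real.exp (-u) := by
      refine setIntegral_mono_on (hc.sub hs) (integrableOn_exp_neg_Ioi 0) measurableSet_Ioi ?_
      intro u hu
      rw [h4]
      refine mul_le_of_le_one_right (Real.exp_pos _).le (Real.exp_le_one_iff.2 ?_)
      have := Real.sinh_nonneg_iff.2 (le_of_lt hu)
      rw [neg_nonpos]; positivity
    have h6 : 0 ≤ ∫ u in Ioi (0 : ℝ), (Real.cosh u * Real.exp (-(r * Real.sinh u)) -
          Real.sinh u * Real.exp (-(r * Real.sinh u))) :=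
      integral_nonneg fun u => by rw [h4]; positivity
    rw [h2] at h5
    constructor <;> nlinarith
  refine tendsto_of_tendsto_of_tendsto_of_le_of_le' tendsto_const_nhds
    (h := fun r => -1 + r) ?_ ?_ ?_
  · have : Tendsto (fun r : ℝ => -1 + r) (𝓝[>] 0) (𝓝 (-1 + 0)) :=
      tendsto_const_nhds.add nhdsWithin_le_nhds
    simpa using this
  · filter_upwards [self_mem_nhdsWithin] with r hr using (hle r hr).1
  · filter_upwards [self_mem_nhdsWithin] with r hr using (hle r hr).2

/-! ### Logarithmic behaviour at the origin -/

theorem integrableOn_log_mul_exp_neg :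
    IntegrableOn (fun x => Real.log x * Real.exp (-x)) (Ioi 0) := by
  have h1 := Real.GammaIntegral_convergent (s := 1 / 2) (by norm_num)
  have h2 := Real.GammaIntegral_convergent (s := 2) (by norm_num)
  refine ((h1.const_mul 2).add h2).mono' (by fun_prop) ?_
  filter_upwards [ae_restrict_mem measurableSet_Ioi] with x hx
  have hx : 0 < x := hx
  rw [norm_mul, Real.norm_eq_abs, Real.norm_of_nonneg (Real.exp_pos _).le, mul_comm]
  simp only [Pi.add_apply]
  rw [show 2 * (Real.exp (-x) * x ^ ((1 : ℝ) / 2 - 1)) + Real.exp (-x) * x ^ ((2 : ℝ) - 1) =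
    Real.exp (-x) * (2 * x ^ ((1 : ℝ) / 2 - 1) + x ^ ((2 : ℝ) - 1)) by ring]
  gcongr
  have h0 : 0 ≤ 2 * x ^ ((1 : ℝ) / 2 - 1) := by positivity
  have h3 : x ^ ((2 : ℝ) - 1) = x := by norm_num
  rw [h3]
  rcases le_total x 1 with h | h
  · have h4 := Real.abs_log_mul_self_rpow_lt x (1 / 2) hx h (by norm_num)
    rw [abs_mul, abs_of_pos (Real.rpow_pos_of_pos hx _)] at h4
    rw [show (1 : ℝ) / 2 - 1 = -(1 / 2) by norm_num, Real.rpow_neg hx.le]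
    have h5 : |Real.log x| ≤ 2 * (x ^ ((1 : ℝ) / 2))⁻¹ := by
      rw [← div_eq_mul_inv, le_div_iff₀ (Real.rpow_pos_of_pos hx _)]
      norm_num at h4 ⊢; exact h4.le
    linarith
  · rw [abs_of_nonneg (Real.log_nonneg h)]
    linarith [Real.log_le_self hx.le]

/-- The left side is the derivative of the Gamma integral at `s = 1`, and `Γ'(1) = -γ`. This is
where Euler's constant enters the integral representation. -/
theorem integral_log_mul_exp_neg :
    ∫ x in Ioi (0 : ℝ), Real.log x * Real.exp (-x) = -Real.eulerMascheroniConstant := by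
  have h1 := Complex.hasDerivAt_GammaIntegral (s := 1) (by simp)
  have h2 : HasDerivAt Complex.GammaIntegral (-Real.eulerMascheroniConstant : ℂ) 1 := by
    refine Complex.hasDerivAt_Gamma_one.congr_of_eventuallyEq ?_
    filter_upwards [(continuous_re.isOpen_preimage _ isOpen_Ioi).mem_nhds
      (show (1 : ℂ) ∈ re ⁻¹' Ioi 0 by simp)] with s hs
    exact (Complex.Gamma_eq_integral hs).symm
  have h3 := h1.unique h2
  simp only [sub_self, cpow_zero, one_mul, ← ofReal_mul] at h3
  have h4 : ((∫ x in Ioi (0 : ℝ), Real.log x * Real.exp (-x) : ℝ) : ℂ) =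
      -Real.eulerMascheroniConstant := by rw [← h3]; exact integral_ofReal.symm
  exact_mod_cast h4

theorem integrableOn_id_mul_exp_neg : IntegrableOn (fun x => x * Real.exp (-x)) (Ioi 0) := by
  refine (Real.GammaIntegral_convergent (s := 2) (by norm_num)).congr (ae_of_all _ fun x => ?_)
  norm_num [mul_comm]

theorem arsinh_le_self {x : ℝ} (hx : 0 ≤ x) : Real.arsinh x ≤ x := by
  rw [← Real.sinh_le_sinh, Real.sinh_arsinh]; exact Real.self_le_sinh_iff.2 hx

theorem integrableOn_arsinh_mul_exp_neg {r : ℝ} (hr : 0 < r) :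
    IntegrableOn (fun x => Real.arsinh (x / r) * Real.exp (-x)) (Ioi 0) := by
  refine (integrableOn_id_mul_exp_neg.div_const r).mono' (Continuous.aestronglyMeasurable
    ((Real.continuous_arsinh.comp (continuous_id.div_const r)).mul (by fun_prop))) ?_
  filter_upwards [ae_restrict_mem measurableSet_Ioi] with x hx
  have hx : 0 < x := hx
  rw [norm_mul, Real.norm_of_nonneg (Real.arsinh_nonneg_iff.2 (by positivity)),
    Real.norm_of_nonneg (Real.exp_pos _).le, mul_div_right_comm]
  gcongr
  exact arsinh_le_self (by positivity)

/-- Integration by parts against `u`, then the substitution `x = r sinh u`. In this form the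
logarithmic singularity is visible, since `arsinh (x/r) = log (x + √(x² + r²)) - log r`. -/
theorem expSinhIntegral_eq_arsinh {r : ℝ} (hr : 0 < r) :
    expSinhIntegral r = ∫ x in Ioi (0 : ℝ), Real.arsinh (x / r) * Real.exp (-x) := by
  have h1 := integrableOn_mul_exp_of_le (f := fun _ => 1) continuous_const hr
    (fun u _ => by rw [abs_one]; nlinarith [Real.one_le_cosh u])
  have h2 := (integrableOn_mul_exp_of_le (f := fun u => u * Real.cosh u) (by fun_prop) hr
    (fun u hu => by
      rw [abs_of_nonneg (by positivity), sq]
      have := (Real.self_le_sinh_iff.2 hu.le).trans (Real.sinh_lt_cosh u).le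
      gcongr)).const_mul r
  simp only [one_mul] at h1
  have hlim : Tendsto (fun u => u * Real.exp (-(r * Real.sinh u))) atTop (𝓝 0) := by
    refine squeeze_zero' (g := fun u => (1 + 2 / r) * Real.exp (-(r / 2 * Real.sinh u))) ?_ ?_
      (by simpa using (tendsto_exp_neg_mul_sinh (half_pos hr)).const_mul (1 + 2 / r))
    · filter_upwards [eventually_ge_atTop 0] with u hu
      positivity
    filter_upwards [eventually_ge_atTop 0] with u hu
    refine le_trans ?_ (one_add_mul_exp_le hr (Real.sinh_nonneg_iff.2 hu))
    gcongr
    linarith [Real.self_le_sinh_iff.2 hu]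
  have hd : ∀ u : ℝ, HasDerivAt (fun u => u * Real.exp (-(r * Real.sinh u)))
      (Real.exp (-(r * Real.sinh u)) -
        r * (u * Real.cosh u * Real.exp (-(r * Real.sinh u)))) u := fun u =>
    ((hasDerivAt_id' u).mul (hasDerivAt_exp_neg_mul_sinh r u)).congr_deriv (by ring)
  have hint := integral_Ioi_of_hasDerivAt_of_tendsto' (a := 0) (fun x _ => hd x) (h1.sub h2) hlim
  rw [integral_sub h1 h2] at hint
  simp only [zero_mul, sub_zero] at hint
  have hd' : ∀ u : ℝ, HasDerivAt (fun u => r * Real.sinh u) (r * Real.cosh u) u := fun u =>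
    (Real.hasDerivAt_sinh u).const_mul r
  have himage : (fun u => r * Real.sinh u) '' Ici 0 ⊆ Ici 0 := by
    rintro _ ⟨u, hu, rfl⟩
    exact mul_nonneg hr.le (Real.sinh_nonneg_iff.2 hu)
  have heq : ∀ u, ((fun x => Real.arsinh (x / r) * Real.exp (-x)) ∘ fun u => r * Real.sinh u) u *
      (r * Real.cosh u) = r * (u * Real.cosh u * Real.exp (-(r * Real.sinh u))) := fun u => by
    simp only [Function.comp, mul_div_cancel_left₀ _ hr.ne', Real.arsinh_sinh]; ring
  have hcv := integral_comp_mul_deriv_Ioi (f := fun u => r * Real.sinh u)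
    (f' := fun u => r * Real.cosh u) (g := fun x => Real.arsinh (x / r) * Real.exp (-x)) (a := 0)
    (by fun_prop) ?_ (fun x _ => (hd' x).hasDerivWithinAt) (by fun_prop) ?_ ?_
  · simp only [heq, Real.sinh_zero, mul_zero] at hcv
    rw [← hcv, expSinhIntegral]
    linarith
  · refine (tendsto_atTop_mono' _ ?_ tendsto_id).const_mul_atTop hr
    filter_upwards [eventually_ge_atTop 0] with u hu using Real.self_le_sinh_iff.2 hu
  · refine IntegrableOn.mono_set ?_ himage
    exact (integrableOn_Ici_iff_integrableOn_Ioi).2 (integrableOn_arsinh_mul_exp_neg hr)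
  · simp only [heq]
    exact (integrableOn_Ici_iff_integrableOn_Ioi).2 h2

theorem tendsto_expSinhIntegral_add_log :
    Tendsto (fun r => expSinhIntegral r + Real.log r) (𝓝[>] 0)
      (𝓝 (Real.log 2 - Real.eulerMascheroniConstant)) := by
  have h1 : ∫ x in Ioi (0 : ℝ), Real.exp (-x) = 1 := by simpa using integral_exp_neg_Ioi 0
  have hI := integrableOn_exp_neg_Ioi 0
  have heq : ∀ r : ℝ, 0 < r → ∫ x in Ioi (0 : ℝ), Real.log (x + √(x ^ 2 + r ^ 2)) * Real.exp (-x) =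
      expSinhIntegral r + Real.log r := by
    intro r hr
    have h2 : Real.log r = ∫ x in Ioi (0 : ℝ), Real.log r * Real.exp (-x) := by
      rw [integral_const_mul, h1, mul_one]
    rw [h2, expSinhIntegral_eq_arsinh hr, ← integral_add (integrableOn_arsinh_mul_exp_neg hr)
      (hI.const_mul _)]
    refine setIntegral_congr_fun measurableSet_Ioi fun x hx => ?_
    have hx : 0 < x := hx
    rw [← add_mul, Real.arsinh, ← Real.log_mul (by positivity) hr.ne']
    congr 2
    rw [add_mul, div_mul_cancel₀ _ hr.ne']
    congr 1
    rw [show x ^ 2 + r ^ 2 = (1 + (x / r) ^ 2) * r ^ 2 by field_simp; ring,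
      Real.sqrt_mul (by positivity), Real.sqrt_sq hr.le]
  have hlim : ∫ x in Ioi (0 : ℝ), Real.log (x + x) * Real.exp (-x) =
      Real.log 2 - Real.eulerMascheroniConstant := by
    have h2 : Real.log 2 = ∫ x in Ioi (0 : ℝ), Real.log 2 * Real.exp (-x) := by
      rw [integral_const_mul, h1, mul_one]
    rw [sub_eq_add_neg, ← integral_log_mul_exp_neg, h2, ← integral_add (hI.const_mul _)
      integrableOn_log_mul_exp_neg]
    refine setIntegral_congr_fun measurableSet_Ioi fun x hx => ?_
    have hx : 0 < x := hx
    rw [← two_mul, Real.log_mul two_ne_zero hx.ne', add_mul]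
  rw [← hlim]
  -- For `r < 1` the logarithm lies between `log x` and `x + √(x² + r²) ≤ 2x + 1`, which gives an
  -- integrable majorant independent of `r`.
  refine (tendsto_integral_filter_of_dominated_convergence
    (F := fun r x => Real.log (x + √(x ^ 2 + r ^ 2)) * Real.exp (-x))
    (fun x => (|Real.log x| + (2 + 2 * x)) * Real.exp (-x)) ?_ ?_ ?_ ?_).congr' ?_
  · exact Eventually.of_forall fun r => by fun_prop
  · filter_upwards [Ioo_mem_nhdsGT one_pos] with r hr
    filter_upwards [ae_restrict_mem measurableSet_Ioi] with x hx
    have hx : 0 < x := hx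
    rw [norm_mul, Real.norm_eq_abs, Real.norm_of_nonneg (Real.exp_pos _).le]
    gcongr
    have h3 : √(x ^ 2 + r ^ 2) ≤ x + 1 := by
      refine Real.sqrt_le_iff.2 ⟨by positivity, ?_⟩
      nlinarith [hr.1, hr.2]
    have h4 : Real.log x ≤ Real.log (x + √(x ^ 2 + r ^ 2)) :=
      Real.log_le_log hx (by linarith [Real.sqrt_nonneg (x ^ 2 + r ^ 2)])
    have h5 : Real.log (x + √(x ^ 2 + r ^ 2)) ≤ x + √(x ^ 2 + r ^ 2) :=
      Real.log_le_self (by positivity)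
    rw [abs_le]
    constructor <;> linarith [neg_abs_le (Real.log x), abs_nonneg (Real.log x)]
  · have h3 : IntegrableOn (fun x => |Real.log x| * Real.exp (-x)) (Ioi 0) := by
      refine integrableOn_log_mul_exp_neg.norm.congr (ae_of_all _ fun x => ?_)
      simp only [norm_mul, Real.norm_eq_abs, abs_of_nonneg (Real.exp_pos _).le]
    refine ((h3.add (hI.const_mul 2)).add (integrableOn_id_mul_exp_neg.const_mul 2)).congr
      (ae_of_all _ fun x => ?_)
    simp only [Pi.add_apply]; ring
  · filter_upwards [ae_restrict_mem measurableSet_Ioi] with x hx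
    have hx : 0 < x := hx
    have h3 : Tendsto (fun r : ℝ => x + √(x ^ 2 + r ^ 2)) (𝓝[>] 0) (𝓝 (x + √(x ^ 2 + 0 ^ 2))) :=
      ((by fun_prop : Continuous fun r : ℝ => x + √(x ^ 2 + r ^ 2)).tendsto 0).mono_left
        nhdsWithin_le_nhds
    rw [zero_pow two_ne_zero, add_zero, Real.sqrt_sq hx.le] at h3
    exact (h3.log (by positivity)).mul_const _
  · filter_upwards [self_mem_nhdsWithin] with r hr using heq r hr

/-! ### The Hankel function as an integral -/

/-- `∫_{-π/2}^{π/2} e^{i r cos θ} dθ`. -/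
def expCosIntegral (r : ℝ) : ℂ :=
  ∫ θ in (-(Real.pi / 2))..(Real.pi / 2), cexp (I * ((r * Real.cos θ : ℝ) : ℂ))

/-- `r` times the derivative of `expCosIntegral`. -/
def expCosFlux (r : ℝ) : ℂ :=
  r * ∫ θ in (-(Real.pi / 2))..(Real.pi / 2),
    I * (Real.cos θ : ℂ) * cexp (I * ((r * Real.cos θ : ℝ) : ℂ))

theorem norm_exp_I_mul_real (x : ℝ) : ‖cexp (I * (x : ℂ))‖ = 1 := by
  rw [mul_comm, norm_exp_ofReal_mul_I]

theorem hasDerivAt_integral_mul_exp_cos {f : ℝ → ℂ} (hf : Continuous f) (r : ℝ) :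
    HasDerivAt (fun r : ℝ => ∫ θ in (-(Real.pi / 2))..(Real.pi / 2),
        f θ * cexp (I * ((r * Real.cos θ : ℝ) : ℂ)))
      (∫ θ in (-(Real.pi / 2))..(Real.pi / 2),
        I * (Real.cos θ : ℂ) * (f θ * cexp (I * ((r * Real.cos θ : ℝ) : ℂ)))) r := by
  have hF : ∀ x : ℝ, Continuous fun θ : ℝ => f θ * cexp (I * ((x * Real.cos θ : ℝ) : ℂ)) :=
    fun x => by fun_prop
  have hF' : Continuous fun θ : ℝ =>
      I * (Real.cos θ : ℂ) * (f θ * cexp (I * ((r * Real.cos θ : ℝ) : ℂ))) := by fun_prop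
  refine (intervalIntegral.hasDerivAt_integral_of_dominated_loc_of_deriv_le (μ := volume)
    (x₀ := r) (s := univ) (bound := fun θ => ‖f θ‖)
    (F := fun (r : ℝ) θ => f θ * cexp (I * ((r * Real.cos θ : ℝ) : ℂ)))
    (F' := fun (r : ℝ) θ => I * (Real.cos θ : ℂ) * (f θ * cexp (I * ((r * Real.cos θ : ℝ) : ℂ))))
    univ_mem (Eventually.of_forall fun x => (hF x).aestronglyMeasurable)
    ((hF r).intervalIntegrable _ _) hF'.aestronglyMeasurable ?_
    (hf.norm.intervalIntegrable _ _) ?_).2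
  · refine ae_of_all _ fun θ _ x _ => ?_
    rw [norm_mul, norm_mul, norm_mul, norm_exp_I_mul_real, norm_I, norm_real, one_mul, mul_one]
    exact mul_le_of_le_one_left (norm_nonneg _) (Real.abs_cos_le_one θ)
  · refine ae_of_all _ fun θ _ x _ => ?_
    refine (((((hasDerivAt_id' x).mul_const (Real.cos θ)).ofReal_comp.const_mul I).cexp).const_mul
      (f θ)).congr_deriv ?_
    push_cast; ring

theorem hasDerivAt_expCosIntegral {r : ℝ} (hr : 0 < r) :
    HasDerivAt expCosIntegral (expCosFlux r / r) r := by
  have h := hasDerivAt_integral_mul_exp_cos (f := fun _ => 1) continuous_const r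
  simp only [one_mul] at h
  refine h.congr_deriv ?_
  rw [expCosFlux, mul_div_cancel_left₀ _ (by exact_mod_cast hr.ne')]

/-- Integrating the `θ`-derivative of `sin θ * exp (i r cos θ)` produces the boundary values at
`±π/2`. Their total, `2`, is the origin of the source `2i`. -/
theorem hasDerivAt_expCosFlux {r : ℝ} (hr : 0 < r) :
    HasDerivAt expCosFlux (2 * I - r * expCosIntegral r) r := by
  have hr' : (r : ℂ) ≠ 0 := by exact_mod_cast hr.ne'
  have h := (hasDerivAt_id' r).ofReal_comp.mul
    (hasDerivAt_integral_mul_exp_cos (f := fun θ => I * (Real.cos θ : ℂ)) (by fun_prop) r)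
  refine h.congr_deriv ?_
  have hd : ∀ θ : ℝ, HasDerivAt
      (fun θ : ℝ => (Real.sin θ : ℂ) * cexp (I * ((r * Real.cos θ : ℝ) : ℂ)))
      ((Real.cos θ : ℂ) * cexp (I * ((r * Real.cos θ : ℝ) : ℂ)) -
        I * r * ((Real.sin θ : ℂ) ^ 2 * cexp (I * ((r * Real.cos θ : ℝ) : ℂ)))) θ := fun θ =>
    ((Real.hasDerivAt_sin θ).ofReal_comp.mul
      ((((Real.hasDerivAt_cos θ).const_mul r).ofReal_comp.const_mul I).cexp)).congr_deriv
      (by push_cast; ring)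
  have hint := intervalIntegral.integral_eq_sub_of_hasDerivAt
    (a := -(Real.pi / 2)) (b := Real.pi / 2) (fun θ _ => hd θ)
    (Continuous.intervalIntegrable (by fun_prop) _ _)
  rw [intervalIntegral.integral_sub (Continuous.intervalIntegrable (by fun_prop) _ _)
    (Continuous.intervalIntegrable (by fun_prop) _ _), intervalIntegral.integral_const_mul] at hint
  have hs : ∀ θ : ℝ, (Real.sin θ : ℂ) ^ 2 = 1 - (Real.cos θ : ℂ) ^ 2 := fun θ => by
    exact_mod_cast Real.sin_sq θ
  simp only [hs, sub_mul, one_mul] at hint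
  rw [intervalIntegral.integral_sub (Continuous.intervalIntegrable (by fun_prop) _ _)
    (Continuous.intervalIntegrable (by fun_prop) _ _)] at hint
  simp only [Real.sin_neg, Real.sin_pi_div_two, Real.cos_neg, Real.cos_pi_div_two, mul_zero,
    ofReal_zero, Complex.exp_zero, ofReal_neg, ofReal_one] at hint
  have h1 : ∫ θ in (-(Real.pi / 2))..(Real.pi / 2), I * (Real.cos θ : ℂ) * (I * (Real.cos θ : ℂ) *
      cexp (I * ((r * Real.cos θ : ℝ) : ℂ))) = -∫ θ in (-(Real.pi / 2))..(Real.pi / 2),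
        (Real.cos θ : ℂ) ^ 2 * cexp (I * ((r * Real.cos θ : ℝ) : ℂ)) := by
    rw [← intervalIntegral.integral_neg]
    congr 1; ext θ; ring_nf; rw [I_sq]; ring
  have h2 : ∫ θ in (-(Real.pi / 2))..(Real.pi / 2), I * (Real.cos θ : ℂ) *
      cexp (I * ((r * Real.cos θ : ℝ) : ℂ)) = I * ∫ θ in (-(Real.pi / 2))..(Real.pi / 2),
        (Real.cos θ : ℂ) * cexp (I * ((r * Real.cos θ : ℝ) : ℂ)) := by
    simp only [mul_assoc I, intervalIntegral.integral_const_mul]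
  rw [h1, h2, expCosIntegral, ofReal_one, one_mul]
  linear_combination I * hint + (r * ((∫ θ in (-(Real.pi / 2))..(Real.pi / 2),
    cexp (I * ((r * Real.cos θ : ℝ) : ℂ))) - ∫ θ in (-(Real.pi / 2))..(Real.pi / 2),
      (Real.cos θ : ℂ) ^ 2 * cexp (I * ((r * Real.cos θ : ℝ) : ℂ)))) * I_sq

theorem tendsto_expCosIntegral : Tendsto expCosIntegral (𝓝[>] 0) (𝓝 Real.pi) := by
  have h := (hasDerivAt_integral_mul_exp_cos (f := fun _ => 1) continuous_const 0).continuousAt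
  simp only [ContinuousAt, one_mul, zero_mul, ofReal_zero, mul_zero, Complex.exp_zero,
    intervalIntegral.integral_const, sub_neg_eq_add, add_halves] at h
  rw [show ((Real.pi : ℝ) : ℂ) = Real.pi • (1 : ℂ) by simp]
  exact h.mono_left (nhdsWithin_le_nhds (s := Ioi 0))

theorem tendsto_expCosFlux : Tendsto expCosFlux (𝓝[>] 0) (𝓝 0) := by
  have h := (continuous_ofReal.continuousAt (x := (0 : ℝ))).mul
    (hasDerivAt_integral_mul_exp_cos (f := fun θ => I * (Real.cos θ : ℂ))
      (by fun_prop) 0).continuousAt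
  simp only [ContinuousAt, Pi.mul_apply, ofReal_zero, zero_mul] at h
  exact h.mono_left (nhdsWithin_le_nhds (s := Ioi 0))

theorem tendsto_log_half_mul_self :
    Tendsto (fun r : ℝ => (Real.log (r / 2) + Real.eulerMascheroniConstant) * r) (𝓝[>] 0)
      (𝓝 0) := by
  have h0 : Tendsto (fun r : ℝ => r) (𝓝[>] 0) (𝓝 0) := nhdsWithin_le_nhds
  have h1 := tendsto_log_mul_rpow_nhdsGT_zero (r := 1) one_pos
  simp only [Real.rpow_one] at h1
  have h2 := h1.add (h0.const_mul (Real.eulerMascheroniConstant - Real.log 2))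
  simp only [mul_zero, add_zero] at h2
  refine h2.congr' ?_
  filter_upwards [self_mem_nhdsWithin] with r hr
  rw [Real.log_div (ne_of_gt hr) two_ne_zero]; ring

theorem tendsto_sq_div_four : Tendsto (fun r : ℝ => r ^ 2 / 4) (𝓝[>] 0) (𝓝 0) := by
  have : Continuous fun r : ℝ => r ^ 2 / 4 := by fun_prop
  simpa using (this.tendsto 0).mono_left (nhdsWithin_le_nhds (s := Ioi 0))

theorem tendsto_besselJ0 : Tendsto besselJ0 (𝓝[>] 0) (𝓝 1) := by
  rw [funext besselJ0_eq]
  have h := (tendsto_tsum_mul_pow_zero summable_coeffJ).comp tendsto_sq_div_four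
  rwa [show coeffJ 0 = 1 by simp [coeffJ]] at h

theorem tendsto_eulerJ : Tendsto (fun r : ℝ => eulerJ (r ^ 2 / 4)) (𝓝[>] 0) (𝓝 0) := by
  have h := (tendsto_tsum_mul_pow_zero
    (summable_nat_mul_mul_pow summable_coeffJ)).comp tendsto_sq_div_four
  rwa [Nat.cast_zero, zero_mul] at h

theorem tendsto_eulerY : Tendsto (fun r : ℝ => eulerY (r ^ 2 / 4)) (𝓝[>] 0) (𝓝 0) := by
  have h := (tendsto_tsum_mul_pow_zero
    (summable_nat_mul_mul_pow summable_coeffY)).comp tendsto_sq_div_four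
  rwa [Nat.cast_zero, zero_mul] at h

theorem tendsto_seriesY : Tendsto (fun r : ℝ => seriesY (r ^ 2 / 4)) (𝓝[>] 0) (𝓝 0) := by
  have h := (tendsto_tsum_mul_pow_zero summable_coeffY).comp tendsto_sq_div_four
  rwa [show coeffY 0 = 0 by simp [coeffY]] at h

theorem exists_abs_tsum_sub_le {a : ℕ → ℝ} (ha : ∀ x : ℝ, Summable fun m => a m * x ^ m) :
    ∃ C, ∀ x : ℝ, 0 < x → x ≤ 1 → |(∑' m, a m * x ^ m) - a 0| ≤ C * x := by
  have hs := (summable_nat_add_iff 1).2 (ha 1).abs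
  refine ⟨∑' m, |a (m + 1) * 1 ^ (m + 1)|, fun x hx hx1 => ?_⟩
  rw [(ha x).tsum_eq_zero_add, pow_zero, mul_one, add_sub_cancel_left, ← tsum_mul_right]
  rw [← Real.norm_eq_abs]
  refine tsum_of_norm_bounded (hs.mul_right x).hasSum fun m => ?_
  rw [Real.norm_eq_abs, one_pow, mul_one, abs_mul, abs_of_nonneg (by positivity : 0 ≤ x ^ (m + 1)),
    pow_succ]
  gcongr
  exact mul_le_of_le_one_left hx.le (pow_le_one₀ hx.le hx1)

/-- Without its constant term the series is `O(r²)`, which beats the logarithm. It handles the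
products of `log` with `seriesJ` and `eulerJ` in `besselY0` and its flux. -/
theorem tendsto_log_half_mul_tsum {a : ℕ → ℝ} (ha : ∀ x : ℝ, Summable fun m => a m * x ^ m) :
    Tendsto (fun r : ℝ => (Real.log (r / 2) + Real.eulerMascheroniConstant) *
      ((∑' m, a m * (r ^ 2 / 4) ^ m) - a 0)) (𝓝[>] 0) (𝓝 0) := by
  obtain ⟨C, hC⟩ := exists_abs_tsum_sub_le ha
  refine squeeze_zero_norm' (a := fun r : ℝ =>
    |(Real.log (r / 2) + Real.eulerMascheroniConstant) * r| * (|C| * (r / 4))) ?_ ?_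
  · filter_upwards [Ioo_mem_nhdsGT one_pos] with r hr
    have h := hC (r ^ 2 / 4) (by have := hr.1; positivity) (by nlinarith [hr.1, hr.2])
    rw [norm_mul, Real.norm_eq_abs, Real.norm_eq_abs, abs_mul, mul_assoc, abs_of_pos hr.1]
    gcongr
    refine h.trans ?_
    calc C * (r ^ 2 / 4) ≤ |C| * (r ^ 2 / 4) := by gcongr; exact le_abs_self C
      _ = _ := by ring
  · have hid : Tendsto (fun r : ℝ => r) (𝓝[>] 0) (𝓝 0) := nhdsWithin_le_nhds
    have h0 := (hid.div_const 4).const_mul |C|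
    simpa using tendsto_log_half_mul_self.abs.mul h0

/-- Integral representation of the Hankel function. -/
theorem hankel_eq_integral {r : ℝ} (hr : 0 < r) :
    expCosIntegral r - 2 * I * expSinhIntegral r = Real.pi * hankelH0 r := by
  have hpi : (Real.pi : ℂ) ≠ 0 := by exact_mod_cast Real.pi_ne_zero
  have hJ0 : coeffJ 0 = 1 := by simp [coeffJ]
  -- The sources `2i` and `2i · 1` cancel, so the difference of the two sides solves the homogeneous
  -- system and only its limits at the origin need checking.
  have key := bessel_system_unique_complex
    (D := fun r => expCosIntegral r - 2 * I * expSinhIntegral r -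
      Real.pi * (besselJ0 r + I * besselY0 r))
    (p := fun r => expCosFlux r - 2 * I * expSinhFlux r -
      Real.pi * (besselJ0Flux r + I * besselY0Flux r)) ?_ ?_ ?_ ?_ hr
  · rw [hankelH0]; exact sub_eq_zero.1 key
  · intro x hx
    refine (((hasDerivAt_expCosIntegral hx).sub
      ((hasDerivAt_expSinhIntegral hx).ofReal_comp.const_mul (2 * I))).sub
      (((hasDerivAt_besselJ0 hx).ofReal_comp.add
        ((hasDerivAt_besselY0 hx).ofReal_comp.const_mul I)).const_mul _)).congr_deriv ?_
    push_cast; ring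
  · intro x hx
    refine (((hasDerivAt_expCosFlux hx).sub
      ((hasDerivAt_expSinhFlux hx).ofReal_comp.const_mul (2 * I))).sub
      (((hasDerivAt_besselJ0Flux hx).ofReal_comp.add
        ((hasDerivAt_besselY0Flux hx).ofReal_comp.const_mul I)).const_mul _)).congr_deriv ?_
    push_cast; ring
  · have h1 := tendsto_expCosIntegral.sub (tendsto_besselJ0.ofReal.const_mul (Real.pi : ℂ))
    -- The singularities match: `expSinhIntegral r` behaves like `-log r + log 2 - γ`, and `(π/2)
    -- Y₀(r)` like `log (r/2) + γ`.
    have h2 : Tendsto (fun r => expSinhIntegral r + Real.pi / 2 * besselY0 r) (𝓝[>] 0) (𝓝 0) := by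
      have h3 := ((tendsto_expSinhIntegral_add_log.add
        (tendsto_log_half_mul_tsum summable_coeffJ)).sub tendsto_seriesY).add_const
          (Real.eulerMascheroniConstant - Real.log 2)
      simp only [hJ0, add_zero, sub_zero, sub_add_sub_cancel, sub_self] at h3
      refine h3.congr' ?_
      filter_upwards [self_mem_nhdsWithin] with x hx
      rw [besselY0_eq, seriesJ, Real.log_div (ne_of_gt hx) two_ne_zero]
      field_simp; ring
    have h3 := h1.sub (h2.ofReal.const_mul (2 * I))
    simp only [ofReal_one, mul_one, sub_self, ofReal_zero, mul_zero] at h3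
    refine h3.congr fun x => ?_
    push_cast; ring
  · have h1 := tendsto_expCosFlux.sub ((tendsto_eulerJ.const_mul 2).ofReal.const_mul (Real.pi : ℂ))
    have h2 : Tendsto (fun r => expSinhFlux r + Real.pi / 2 * besselY0Flux r) (𝓝[>] 0) (𝓝 0) := by
      have h3 := ((tendsto_expSinhFlux.add tendsto_besselJ0).add
        ((tendsto_log_half_mul_tsum (summable_nat_mul_mul_pow summable_coeffJ)).const_mul 2)).sub
          (tendsto_eulerY.const_mul 2)
      norm_num at h3
      refine h3.congr fun x => ?_
      rw [besselY0Flux, besselJ0_eq, eulerJ]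
      field_simp; ring
    have h3 := h1.sub (h2.ofReal.const_mul (2 * I))
    simp only [mul_zero, sub_self, ofReal_zero] at h3
    refine h3.congr fun x => ?_
    rw [besselJ0Flux]
    push_cast; ring

/-! ### Rotation invariance of the plane wave superposition -/

/-- The superposition of the propagating plane waves. -/
def propagatingPart (s t : ℝ) : ℂ := ∫ θ in (-(Real.pi / 2))..(Real.pi / 2),
  cexp (I * ((s * Real.sin θ + t * Real.cos θ : ℝ) : ℂ))

/-- The superposition of the evanescent plane waves. -/
def evanescentPart (s t : ℝ) : ℝ :=
  ∫ u in Ioi (0 : ℝ), Real.cos (s * Real.cosh u) * Real.exp (-(t * Real.sinh u))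

theorem propagatingPart_polar (r φ : ℝ) :
    propagatingPart (r * Real.sin φ) (r * Real.cos φ) =
      ∫ θ in (-(Real.pi / 2) - φ)..(Real.pi / 2 - φ), cexp (I * ((r * Real.cos θ : ℝ) : ℂ)) := by
  rw [← intervalIntegral.integral_comp_sub_right
    (fun θ : ℝ => cexp (I * ((r * Real.cos θ : ℝ) : ℂ))) φ, propagatingPart]
  congr 1; ext θ
  rw [Real.cos_sub]; congr 3; ring

/-- Turning the direction by `φ` only shifts the range of integration, so the derivative consists of
the integrand at the two moving endpoints. -/
theorem hasDerivAt_propagatingPart_polar (r φ : ℝ) :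
    HasDerivAt (fun φ => propagatingPart (r * Real.sin φ) (r * Real.cos φ))
      (-(2 * I * (Real.sin (r * Real.sin φ) : ℂ))) φ := by
  have hc : Continuous fun θ : ℝ => cexp (I * ((r * Real.cos θ : ℝ) : ℂ)) := by fun_prop
  have hW : ∀ x, HasDerivAt (fun x => ∫ θ in (0 : ℝ)..x, cexp (I * ((r * Real.cos θ : ℝ) : ℂ)))
      (cexp (I * ((r * Real.cos x : ℝ) : ℂ))) x := fun x =>
    (hc.integral_hasStrictDerivAt 0 x).hasDerivAt
  have heq : (fun φ => propagatingPart (r * Real.sin φ) (r * Real.cos φ)) = fun φ =>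
      (∫ θ in (0 : ℝ)..(Real.pi / 2 - φ), cexp (I * ((r * Real.cos θ : ℝ) : ℂ))) -
        ∫ θ in (0 : ℝ)..(-(Real.pi / 2) - φ), cexp (I * ((r * Real.cos θ : ℝ) : ℂ)) := by
    ext φ
    rw [propagatingPart_polar, intervalIntegral.integral_interval_sub_left
      (hc.intervalIntegrable _ _) (hc.intervalIntegrable _ _)]
  rw [heq]
  refine (((hW _).scomp φ ((hasDerivAt_id' φ).const_sub _)).sub
    ((hW _).scomp φ ((hasDerivAt_id' φ).const_sub _))).congr_deriv ?_
  have h1 : Real.cos (-(Real.pi / 2) - φ) = -Real.sin φ := by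
    rw [← Real.cos_neg, show -(-(Real.pi / 2) - φ) = φ + Real.pi / 2 by ring,
      Real.cos_add_pi_div_two]
  rw [Real.cos_pi_div_two_sub, h1, ofReal_sin, Complex.sin]
  simp only [neg_smul, one_smul]
  push_cast
  rw [show I * (r * -(Complex.sin φ)) = -(r * Complex.sin φ) * I by ring,
    show I * (r * (Complex.sin φ)) = (r * Complex.sin φ) * I by ring]
  linear_combination (cexp (-(r * Complex.sin φ) * I) - cexp ((r * Complex.sin φ) * I)) * I_sq

/-- The `φ`-derivative of the integrand is an exact `u`-derivative, namely of `sin (r sin φ cosh u)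
* exp (-r cos φ sinh u)`. Only the boundary term at `u = 0` survives, and it balances the endpoint
terms of `propagatingPart`. -/
theorem hasDerivAt_evanescentPart_polar {r φ : ℝ} (hr : 0 < r)
    (hφ : φ ∈ Ioo (-(Real.pi / 2)) (Real.pi / 2)) :
    HasDerivAt (fun φ => evanescentPart (r * Real.sin φ) (r * Real.cos φ))
      (-Real.sin (r * Real.sin φ)) φ := by
  have hcos : 0 < Real.cos φ := Real.cos_pos_of_mem_Ioo hφ
  -- Half of the decay rate at `φ` is still available for all angles in a neighbourhood, which makes
  -- the domination uniform.
  set c := r * (Real.cos φ / 2) with hc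
  have hc0 : 0 < c := by positivity
  have hnhds : {x | Real.cos φ / 2 < Real.cos x} ∈ 𝓝 φ :=
    Real.continuous_cos.continuousAt.eventually (lt_mem_nhds (by linarith))
  let F' : ℝ → ℝ → ℝ := fun φ u =>
    (r * Real.sin φ * Real.sinh u * Real.cos (r * Real.sin φ * Real.cosh u) -
      r * Real.cos φ * Real.cosh u * Real.sin (r * Real.sin φ * Real.cosh u)) *
        Real.exp (-(r * Real.cos φ * Real.sinh u))
  have hF'c : Continuous (F' φ) := by fun_prop
  have h := hasDerivAt_integral_of_dominated_loc_of_deriv_le (μ := volume.restrict (Ioi 0))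
    (x₀ := φ) (s := {x | Real.cos φ / 2 < Real.cos x})
    (F := fun φ u => Real.cos (r * Real.sin φ * Real.cosh u) *
      Real.exp (-(r * Real.cos φ * Real.sinh u)))
    (F' := F')
    (bound := fun u => 2 * r * (Real.cosh u * Real.exp (-(c * Real.sinh u))))
    hnhds (Eventually.of_forall fun x => Continuous.aestronglyMeasurable (by fun_prop))
    (integrableOn_mul_exp_of_le (by fun_prop) (by positivity) fun u hu =>
      (Real.abs_cos_le_one _).trans (by nlinarith [Real.one_le_cosh u]))
    hF'c.aestronglyMeasurable ?_ ((integrableOn_cosh_mul_exp hc0).const_mul _) ?_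
  · refine h.2.congr_deriv ?_
    have hd : ∀ u : ℝ, HasDerivAt (fun u => Real.sin (r * Real.sin φ * Real.cosh u) *
        Real.exp (-(r * Real.cos φ * Real.sinh u))) (F' φ u) u := fun u =>
      ((((Real.hasDerivAt_cosh u).const_mul _).sin).mul
        (hasDerivAt_exp_neg_mul_sinh _ u)).congr_deriv (by simp only [F']; ring)
    have hlim : Tendsto (fun u => Real.sin (r * Real.sin φ * Real.cosh u) *
        Real.exp (-(r * Real.cos φ * Real.sinh u))) atTop (𝓝 0) := by
      refine squeeze_zero_norm (fun u => ?_) (tendsto_exp_neg_mul_sinh (mul_pos hr hcos))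
      rw [norm_mul, Real.norm_of_nonneg (Real.exp_pos _).le]
      exact mul_le_of_le_one_left (Real.exp_pos _).le (Real.abs_sin_le_one _)
    rw [integral_Ioi_of_hasDerivAt_of_tendsto' (fun u _ => hd u) h.1 hlim]
    simp
  · filter_upwards [ae_restrict_mem measurableSet_Ioi] with u hu x hx
    have hx : Real.cos φ / 2 < Real.cos x := hx
    have h0 := Real.sinh_nonneg_iff.2 (le_of_lt hu)
    have h1 := (Real.sinh_lt_cosh u).le
    have h2 := Real.cosh_pos u
    rw [norm_mul, Real.norm_of_nonneg (Real.exp_pos _).le, ← mul_assoc]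
    have hb : ∀ a b d e : ℝ, |a| ≤ 1 → 0 ≤ b → b ≤ Real.cosh u → |d| ≤ 1 → e = r * a * b * d →
        |e| ≤ r * Real.cosh u := by
      intro a b d e ha hb0 hb hd he
      rw [he, abs_mul, abs_mul, abs_mul, abs_of_pos hr, abs_of_nonneg hb0]
      calc r * |a| * b * |d| ≤ r * 1 * Real.cosh u * 1 := by gcongr
        _ = _ := by ring
    gcongr
    · refine (abs_sub _ _).trans ?_
      have := hb _ _ _ _ (Real.abs_sin_le_one x) h0 h1
        (Real.abs_cos_le_one (r * Real.sin x * Real.cosh u)) rfl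
      have := hb _ _ _ _ (Real.abs_cos_le_one x) h2.le le_rfl
        (Real.abs_sin_le_one (r * Real.sin x * Real.cosh u)) rfl
      linarith
    · exact mul_le_mul_of_nonneg_left hx.le hr.le
  · refine ae_of_all _ fun u x _ => ?_
    refine ((((((Real.hasDerivAt_sin x).const_mul r).mul_const (Real.cosh u)).cos).mul
      (((((Real.hasDerivAt_cos x).const_mul r).mul_const (Real.sinh u)).fun_neg).exp))).congr_deriv
        ?_
    simp only [F']; ring

/-- In polar coordinates the left side has zero angular derivative for `|φ| < π/2`, so it equals its
value at `φ = 0`, where `hankel_eq_integral` applies. This replaces a contour deformation. -/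
theorem planeWave_eq_hankel (s : ℝ) {t : ℝ} (ht : 0 < t) :
    propagatingPart s t - 2 * I * evanescentPart s t =
      Real.pi * hankelH0 (√(s ^ 2 + t ^ 2)) := by
  set z : ℂ := ⟨t, s⟩ with hz
  have hr : ‖z‖ = √(s ^ 2 + t ^ 2) := by
    rw [Complex.norm_def, normSq_mk]; congr 1; ring
  have hz0 : z ≠ 0 := fun h => by
    have := congrArg re h
    exact ht.ne' (by simpa [hz] using this)
  have hrpos : 0 < ‖z‖ := norm_pos_iff.2 hz0
  have harg : z.arg ∈ Ioo (-(Real.pi / 2)) (Real.pi / 2) :=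
    abs_lt.1 (abs_arg_lt_pi_div_two_iff.2 (Or.inl ht))
  have hs : s = ‖z‖ * Real.sin z.arg := by rw [Complex.norm_mul_sin_arg]
  have ht' : t = ‖z‖ * Real.cos z.arg := by rw [Complex.norm_mul_cos_arg]
  have hconst := isOpen_Ioo.is_const_of_deriv_eq_zero
    (s := Ioo (-(Real.pi / 2)) (Real.pi / 2)) (f := fun φ : ℝ =>
      propagatingPart (‖z‖ * Real.sin φ) (‖z‖ * Real.cos φ) -
        2 * I * evanescentPart (‖z‖ * Real.sin φ) (‖z‖ * Real.cos φ))
    isPreconnected_Ioo ?_ ?_ harg (y := 0) ⟨by simp [Real.pi_pos], by simp [Real.pi_pos]⟩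
  · beta_reduce at hconst
    rw [← hs, ← ht', Real.sin_zero, Real.cos_zero, mul_zero, mul_one] at hconst
    rw [hconst, ← hr, ← hankel_eq_integral hrpos]
    simp [propagatingPart, evanescentPart, expCosIntegral, expSinhIntegral]
  all_goals
    have hd : ∀ φ ∈ Ioo (-(Real.pi / 2)) (Real.pi / 2), HasDerivAt (fun φ : ℝ =>
      propagatingPart (‖z‖ * Real.sin φ) (‖z‖ * Real.cos φ) -
        2 * I * evanescentPart (‖z‖ * Real.sin φ) (‖z‖ * Real.cos φ)) 0 φ := fun φ hφ =>
      ((hasDerivAt_propagatingPart_polar ‖z‖ φ).sub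
        ((hasDerivAt_evanescentPart_polar hrpos hφ).ofReal_comp.const_mul (2 * I))).congr_deriv
          (by push_cast; ring)
  · exact fun φ hφ => (hd φ hφ).differentiableAt.differentiableWithinAt
  · exact fun φ hφ => (hd φ hφ).deriv

/-! ### The Hankel function as a Fourier integral over plane waves -/

/-- The vertical wave number `√(k² - ξ²)`, with values in `[0, ∞)` or `i (0, ∞)`. -/
def beta (k ξ : ℝ) : ℂ :=
  if |ξ| ≤ k then (Real.sqrt (k ^ 2 - ξ ^ 2) : ℂ) else I * (Real.sqrt (ξ ^ 2 - k ^ 2) : ℂ)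

/-- The plane wave with horizontal wave number `ξ`, divided by the vertical wave number. -/
def planeMode (k s t ξ : ℝ) : ℂ := 1 / beta k ξ * cexp (I * ξ * s + I * beta k ξ * t)

theorem beta_neg (k ξ : ℝ) : beta k (-ξ) = beta k ξ := by simp [beta]

theorem planeMode_neg (k s t ξ : ℝ) : planeMode k s t (-ξ) = planeMode k (-s) t ξ := by
  rw [planeMode, planeMode, beta_neg]; push_cast; ring_nf

theorem beta_mul_sin {k θ : ℝ} (hk : 0 < k) (hθ : θ ∈ Ioo (-(Real.pi / 2)) (Real.pi / 2)) :
    beta k (k * Real.sin θ) = (k * Real.cos θ : ℝ) := by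
  have hc := Real.cos_pos_of_mem_Ioo hθ
  rw [beta, if_pos, ofReal_inj, show k ^ 2 - (k * Real.sin θ) ^ 2 = (k * Real.cos θ) ^ 2 by
    rw [mul_pow, mul_pow, Real.sin_sq]; ring, Real.sqrt_sq (by positivity)]
  rw [abs_mul, abs_of_pos hk]
  exact mul_le_of_le_one_right hk.le (Real.abs_sin_le_one θ)

theorem beta_mul_cosh {k u : ℝ} (hk : 0 < k) (hu : 0 < u) :
    beta k (k * Real.cosh u) = I * (k * Real.sinh u : ℝ) := by
  have hs := Real.sinh_pos_iff.2 hu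
  rw [beta, if_neg, show (k * Real.cosh u) ^ 2 - k ^ 2 = (k * Real.sinh u) ^ 2 by
    rw [mul_pow, mul_pow, Real.cosh_sq]; ring, Real.sqrt_sq (by positivity)]
  rw [abs_of_pos (by have := Real.cosh_pos u; positivity), not_le]
  exact lt_mul_of_one_lt_right hk (Real.one_lt_cosh.2 hu.ne')

theorem image_mul_sin {k : ℝ} (hk : 0 < k) :
    (fun θ => k * Real.sin θ) '' Ioo (-(Real.pi / 2)) (Real.pi / 2) = Ioo (-k) k := by
  ext ξ
  constructor
  · rintro ⟨θ, hθ, rfl⟩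
    have hc := Real.cos_pos_of_mem_Ioo hθ
    have h : |Real.sin θ| < 1 := by
      rw [← sq_lt_one_iff_abs_lt_one]; nlinarith [Real.sin_sq_add_cos_sq θ]
    have := abs_lt.1 h
    constructor <;> nlinarith
  · rintro ⟨h1, h2⟩
    have h3 : -1 < ξ / k := by rw [lt_div_iff₀ hk]; linarith
    have h4 : ξ / k < 1 := by rw [div_lt_iff₀ hk]; linarith
    refine ⟨Real.arcsin (ξ / k), ⟨Real.neg_pi_div_two_lt_arcsin.2 h3,
      Real.arcsin_lt_pi_div_two.2 h4⟩, ?_⟩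
    beta_reduce
    rw [Real.sin_arcsin h3.le h4.le]; field_simp

theorem image_mul_cosh {k : ℝ} (hk : 0 < k) :
    (fun u => k * Real.cosh u) '' Ioi 0 = Ioi k := by
  ext ξ
  constructor
  · rintro ⟨u, hu, rfl⟩
    exact lt_mul_of_one_lt_right hk (Real.one_lt_cosh.2 (ne_of_gt hu))
  · intro h
    have h : k < ξ := h
    have h1 : 1 < ξ / k := by rw [lt_div_iff₀ hk]; linarith
    refine ⟨Real.arcosh (ξ / k), Real.arcosh_pos h1, ?_⟩
    beta_reduce
    rw [Real.cosh_arcosh h1.le]; field_simp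

/-- The Jacobian of `ξ = k sin θ` is exactly `β`, so the inverse square root singularities at `±k`
disappear. For `ξ = k cosh u` the Jacobian cancels `β` up to the factor `-i`. -/
theorem abs_deriv_smul_planeMode_sin {k θ : ℝ} (hk : 0 < k) (s t : ℝ)
    (hθ : θ ∈ Ioo (-(Real.pi / 2)) (Real.pi / 2)) :
    |k * Real.cos θ| • planeMode k s t (k * Real.sin θ) =
      cexp (I * ((k * s * Real.sin θ + k * t * Real.cos θ : ℝ) : ℂ)) := by
  have hc := Real.cos_pos_of_mem_Ioo hθ
  have hne : ((k * Real.cos θ : ℝ) : ℂ) ≠ 0 := by exact_mod_cast (mul_pos hk hc).ne'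
  rw [planeMode, beta_mul_sin hk hθ, abs_of_pos (by positivity), real_smul, ← mul_assoc,
    mul_one_div_cancel hne, one_mul]
  congr 1; push_cast; ring

theorem abs_deriv_smul_planeMode_cosh {k u : ℝ} (hk : 0 < k) (s t : ℝ) (hu : 0 < u) :
    |k * Real.sinh u| • planeMode k s t (k * Real.cosh u) =
      -I * cexp (I * (k * s * Real.cosh u : ℝ)) * (Real.exp (-(k * t * Real.sinh u)) : ℂ) := by
  have hs := Real.sinh_pos_iff.2 hu
  have hne : ((k * Real.sinh u : ℝ) : ℂ) ≠ 0 := by exact_mod_cast (mul_pos hk hs).ne'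
  rw [planeMode, beta_mul_cosh hk hu, abs_of_pos (by positivity), real_smul, ofReal_exp,
    mul_assoc (-I), ← Complex.exp_add, ← mul_assoc, one_div, mul_inv, mul_left_comm,
    mul_inv_cancel₀ hne, mul_one, inv_I]
  congr 2; push_cast
  linear_combination (k * t * Complex.sinh u) * I_sq

theorem integrableOn_planeMode_Ioo {k : ℝ} (hk : 0 < k) (s t : ℝ) :
    IntegrableOn (planeMode k s t) (Ioo (-k) k) ∧
      ∫ ξ in Ioo (-k) k, planeMode k s t ξ = propagatingPart (k * s) (k * t) := by
  have hd : ∀ θ ∈ Ioo (-(Real.pi / 2)) (Real.pi / 2), HasDerivWithinAt (fun θ => k * Real.sin θ)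
      (k * Real.cos θ) (Ioo (-(Real.pi / 2)) (Real.pi / 2)) θ := fun θ _ =>
    ((Real.hasDerivAt_sin θ).const_mul k).hasDerivWithinAt
  have hinj : InjOn (fun θ => k * Real.sin θ) (Ioo (-(Real.pi / 2)) (Real.pi / 2)) :=
    fun x hx y hy h => Real.injOn_sin (Ioo_subset_Icc_self hx) (Ioo_subset_Icc_self hy)
      (mul_left_cancel₀ hk.ne' h)
  constructor
  · rw [← image_mul_sin hk, integrableOn_image_iff_integrableOn_abs_deriv_smul measurableSet_Ioo
      hd hinj, integrableOn_congr_fun (fun θ hθ => abs_deriv_smul_planeMode_sin hk s t hθ)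
        measurableSet_Ioo]
    refine (ContinuousOn.integrableOn_Icc (Continuous.continuousOn ?_)).mono_set Ioo_subset_Icc_self
    fun_prop
  · rw [← image_mul_sin hk, integral_image_eq_integral_abs_deriv_smul measurableSet_Ioo hd hinj,
      setIntegral_congr_fun measurableSet_Ioo
        (fun θ hθ => abs_deriv_smul_planeMode_sin hk s t hθ), propagatingPart,
      intervalIntegral.integral_of_le (by linarith [Real.pi_pos]), integral_Ioc_eq_integral_Ioo]

theorem integrableOn_evanescent {a b : ℝ} (hb : 0 < b) :
    IntegrableOn (fun u => -I * cexp (I * (a * Real.cosh u : ℝ)) *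
      (Real.exp (-(b * Real.sinh u)) : ℂ)) (Ioi 0) := by
  refine (integrableOn_mul_exp_of_le (f := fun _ => 1) continuous_const hb
    (fun u _ => by rw [abs_one]; nlinarith [Real.one_le_cosh u])).mono'
    (Continuous.aestronglyMeasurable (by fun_prop)) (ae_of_all _ fun u => ?_)
  rw [norm_mul, norm_mul, norm_exp_I_mul_real, norm_neg, norm_I, norm_real,
    Real.norm_of_nonneg (Real.exp_pos _).le]
  simp

theorem integrableOn_planeMode_Ioi {k t : ℝ} (hk : 0 < k) (s : ℝ) (ht : 0 < t) :
    IntegrableOn (planeMode k s t) (Ioi k) ∧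
      ∫ ξ in Ioi k, planeMode k s t ξ = ∫ u in Ioi (0 : ℝ),
        -I * cexp (I * (k * s * Real.cosh u : ℝ)) * (Real.exp (-(k * t * Real.sinh u)) : ℂ) := by
  have hd : ∀ u ∈ Ioi (0 : ℝ), HasDerivWithinAt (fun u => k * Real.cosh u)
      (k * Real.sinh u) (Ioi 0) u := fun u _ =>
    ((Real.hasDerivAt_cosh u).const_mul k).hasDerivWithinAt
  have hinj : InjOn (fun u => k * Real.cosh u) (Ioi 0) :=
    fun x hx y hy h => Real.cosh_strictMonoOn.injOn (Ioi_subset_Ici_self hx)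
      (Ioi_subset_Ici_self hy) (mul_left_cancel₀ hk.ne' h)
  constructor
  · rw [← image_mul_cosh hk, integrableOn_image_iff_integrableOn_abs_deriv_smul measurableSet_Ioi
      hd hinj, integrableOn_congr_fun (s := Ioi 0)
        (fun u hu => abs_deriv_smul_planeMode_cosh hk s t hu) measurableSet_Ioi]
    exact integrableOn_evanescent (by positivity)
  · rw [← image_mul_cosh hk, integral_image_eq_integral_abs_deriv_smul measurableSet_Ioi hd hinj,
      setIntegral_congr_fun measurableSet_Ioi
        (fun u hu => abs_deriv_smul_planeMode_cosh hk s t hu)]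

theorem integrableOn_planeMode_Iic {k t : ℝ} (hk : 0 < k) (s : ℝ) (ht : 0 < t) :
    IntegrableOn (planeMode k s t) (Iic (-k)) ∧
      ∫ ξ in Iic (-k), planeMode k s t ξ = ∫ ξ in Ioi k, planeMode k (-s) t ξ := by
  constructor
  · have h := (integrableOn_planeMode_Ioi hk (-s) ht).1.comp_neg
    simp only [planeMode_neg, neg_neg, neg_Ioi] at h
    exact (integrableOn_Iic_iff_integrableOn_Iio).2 h
  · rw [← integral_comp_neg_Ioi]
    simp only [planeMode_neg]

theorem integrable_planeMode {k t : ℝ} (hk : 0 < k) (s : ℝ) (ht : 0 < t) :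
    Integrable (planeMode k s t) := by
  rw [← integrableOn_univ, ← Iic_union_Ioi (a := -k), ← Ioc_union_Ioi_eq_Ioi (by linarith : -k ≤ k)]
  exact (integrableOn_planeMode_Iic hk s ht).1.union
    (((integrableOn_Ioc_iff_integrableOn_Ioo).2 (integrableOn_planeMode_Ioo hk s t).1).union
      (integrableOn_planeMode_Ioi hk s ht).1)

/-- The plane wave expansion of the Hankel function. -/
theorem integral_planeMode {k t : ℝ} (hk : 0 < k) (s : ℝ) (ht : 0 < t) :
    ∫ ξ, planeMode k s t ξ = Real.pi * hankelH0 (k * √(s ^ 2 + t ^ 2)) := by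
  have hi := integrable_planeMode hk s ht
  rw [← intervalIntegral.integral_Iic_add_Ioi (b := -k) hi.integrableOn hi.integrableOn,
    ← Ioc_union_Ioi_eq_Ioi (by linarith : -k ≤ k), setIntegral_union
      (by rw [Set.disjoint_left]; exact fun x hx hx' => not_lt_of_ge hx.2 hx') measurableSet_Ioi
      hi.integrableOn hi.integrableOn, integral_Ioc_eq_integral_Ioo,
    (integrableOn_planeMode_Ioo hk s t).2, (integrableOn_planeMode_Iic hk s ht).2,
    (integrableOn_planeMode_Ioi hk s ht).2, (integrableOn_planeMode_Ioi hk (-s) ht).2]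
  have hkt : 0 < k * t := by positivity
  -- The tails `ξ < -k` and `ξ > k` carry opposite horizontal phases, which add up to the cosine in
  -- `evanescentPart`.
  have hsum : (∫ u in Ioi (0 : ℝ), -I * cexp (I * (k * -s * Real.cosh u : ℝ)) *
        (Real.exp (-(k * t * Real.sinh u)) : ℂ)) + (∫ u in Ioi (0 : ℝ),
        -I * cexp (I * (k * s * Real.cosh u : ℝ)) * (Real.exp (-(k * t * Real.sinh u)) : ℂ)) =
      -(2 * I * evanescentPart (k * s) (k * t)) := by
    rw [← integral_add (integrableOn_evanescent hkt) (integrableOn_evanescent hkt),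
      evanescentPart, ← integral_complex_ofReal, ← integral_const_mul, ← integral_neg]
    congr 1; ext u
    rw [ofReal_mul (Real.cos _), ofReal_cos, Complex.cos]
    rw [show I * (k * -s * Real.cosh u : ℝ) = -(k * s * Real.cosh u : ℝ) * I by push_cast; ring,
      mul_comm I ((k * s * Real.cosh u : ℝ) : ℂ)]
    ring
  have hroot : k * √(s ^ 2 + t ^ 2) = √((k * s) ^ 2 + (k * t) ^ 2) := by
    rw [mul_pow, mul_pow, ← mul_add, Real.sqrt_mul (by positivity), Real.sqrt_sq hk.le]
  rw [hroot, ← planeWave_eq_hankel _ hkt]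
  linear_combination hsum

/-! ### Pointwise Poisson summation -/

/-- The character `w ↦ e^{-2πiw}`. -/
def negChar (w : ℝ) : ℂ := cexp (I * ((-(2 * Real.pi * w) : ℝ) : ℂ))

theorem continuous_negChar : Continuous negChar := by unfold negChar; fun_prop

theorem norm_negChar (w : ℝ) : ‖negChar w‖ = 1 := norm_exp_I_mul_real _

theorem negChar_add (a b : ℝ) : negChar (a + b) = negChar a * negChar b := by
  rw [negChar, negChar, negChar, ← Complex.exp_add]; congr 1; push_cast; ring

theorem negChar_int (m : ℤ) : negChar m = 1 := by
  rw [negChar, Complex.exp_eq_one_iff]; exact ⟨-m, by push_cast; ring⟩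

theorem negChar_int_mul (n : ℤ) (w : ℝ) : negChar (n * w) = negChar w ^ n := by
  rw [negChar, negChar, ← Complex.exp_int_mul]; congr 1; push_cast; ring

/-- The norm is `2|sin πu|`, and Jordan's inequality applies. -/
theorem norm_negChar_sub_one_ge {u : ℝ} (hu : |u| ≤ 1 / 2) : 4 * |u| ≤ ‖negChar u - 1‖ := by
  have h := norm_exp_I_mul_ofReal_sub_one (-(2 * Real.pi * u))
  rw [negChar, h, norm_mul, Real.norm_ofNat, Real.norm_eq_abs,
    show -(2 * Real.pi * u) / 2 = -(Real.pi * u) by ring, Real.sin_neg, abs_neg]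
  have h1 : Real.pi * |u| ≤ Real.pi / 2 := by nlinarith [Real.pi_pos]
  have h2 := Real.mul_le_sin (x := Real.pi * |u|) (by positivity) h1
  have h3 : |Real.sin (Real.pi * u)| = |Real.sin (Real.pi * |u|)| := by
    rcases abs_choice u with h | h <;> rw [h]
    rw [mul_neg, Real.sin_neg, abs_neg]
  rw [h3]
  have h4 : 2 / Real.pi * (Real.pi * |u|) = 2 * |u| := by field_simp
  linarith [le_abs_self (Real.sin (Real.pi * |u|))]

theorem round_preimage (m : ℤ) :
    {w : ℝ | round w = m} = Ico ((m : ℝ) - 1 / 2) (m + 1 / 2) := by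
  ext w
  rw [mem_ofPred_eq, round_eq, Int.floor_eq_iff, mem_Ico]
  constructor <;> rintro ⟨h1, h2⟩ <;> constructor <;> linarith

theorem integrable_comp_round {a : ℤ → ℂ} (ha : Summable fun m => ‖a m‖) :
    Integrable fun w : ℝ => a (round w) := by
  have hU : (⋃ m : ℤ, {w : ℝ | round w = m}) = univ := by ext w; simp
  rw [← integrableOn_univ, ← hU]
  have hcongr : ∀ m : ℤ, EqOn (fun w : ℝ => a (round w)) (fun _ => a m) {w : ℝ | round w = m} :=
    fun m w hw => by simp only [mem_ofPred_eq] at hw; simp only [hw]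
  have hmeas : ∀ m : ℤ, MeasurableSet {w : ℝ | round w = m} := fun m => by
    rw [round_preimage]; exact measurableSet_Ico
  refine integrableOn_iUnion_of_summable_integral_norm (fun m => ?_) ?_
  · rw [integrableOn_congr_fun (hcongr m) (hmeas m), round_preimage]
    exact integrableOn_const (by simp)
  · refine ha.congr fun m => ?_
    rw [setIntegral_congr_fun (g := fun _ => ‖a m‖) (hmeas m) fun w hw => by
      simp only [hcongr m hw], round_preimage]
    simp; norm_num

theorem integral_negChar_pow (m n : ℤ) :
    ∫ w in Ico ((m : ℝ) - 1 / 2) (m + 1 / 2), negChar w ^ n = if n = 0 then 1 else 0 := by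
  rw [integral_Ico_eq_integral_Ioc, ← intervalIntegral.integral_of_le (by linarith)]
  split_ifs with hn
  · rw [hn]; simp; norm_num
  · have hc : (-(2 * Real.pi * n) * I : ℂ) ≠ 0 := by
      simp [Real.pi_ne_zero, hn]
    have h1 : ∀ w : ℝ, negChar w ^ n = cexp (-(2 * Real.pi * n) * I * w) := fun w => by
      rw [← negChar_int_mul, negChar]; congr 1; push_cast; ring
    simp only [h1]
    rw [integral_exp_mul_complex hc, ← h1, ← h1, ← negChar_int_mul, ← negChar_int_mul]
    rw [show (n : ℝ) * (m + 1 / 2) = n * (m - 1 / 2) + n by ring, negChar_add, negChar_int]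
    simp

/-- A step function on unit cells centred at the integers sees only the frequency `n = 0`, since
nontrivial integer characters have mean zero on each cell. It carries the whole limit in the Poisson
summation. -/
theorem integral_comp_round_mul_negChar {a : ℤ → ℂ} (ha : Summable fun m => ‖a m‖) (n : ℤ) :
    ∫ w : ℝ, a (round w) * negChar w ^ n = if n = 0 then ∑' m, a m else 0 := by
  have hU : (⋃ m : ℤ, {w : ℝ | round w = m}) = univ := by ext w; simp
  have hcongr : ∀ m : ℤ, EqOn (fun w : ℝ => a (round w) * negChar w ^ n)
      (fun w => a m * negChar w ^ n) {w : ℝ | round w = m} :=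
    fun m w hw => by simp only [mem_ofPred_eq] at hw; simp only [hw]
  have hmeas : ∀ m : ℤ, MeasurableSet {w : ℝ | round w = m} := fun m => by
    rw [round_preimage]; exact measurableSet_Ico
  have hint : Integrable fun w : ℝ => a (round w) * negChar w ^ n := by
    refine (integrable_comp_round ha).mul_bdd (c := 1) ?_ (ae_of_all _ fun w => ?_)
    · simp only [← negChar_int_mul]
      exact (continuous_negChar.comp (by fun_prop)).aestronglyMeasurable
    · rw [norm_zpow, norm_negChar, one_zpow]
  have h := hasSum_integral_iUnion hmeas
    (fun i j hij => Set.disjoint_left.2 fun w hw hw' => hij (hw.symm.trans hw')) hint.integrableOn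
  rw [hU, setIntegral_univ] at h
  rw [← h.tsum_eq]
  have h2 : ∀ m : ℤ, ∫ w in {w : ℝ | round w = m}, a (round w) * negChar w ^ n =
      a m * if n = 0 then 1 else 0 := fun m => by
    rw [setIntegral_congr_fun (hmeas m) (hcongr m), round_preimage, integral_const_mul,
      integral_negChar_pow]
  simp only [h2]
  split_ifs <;> simp

theorem tendsto_integral_mul_negChar_pow (f : ℝ → ℂ) {u : ℕ → ℤ}
    (hu : Tendsto (fun N => (u N : ℝ)) atTop (cocompact ℝ)) :
    Tendsto (fun N => ∫ w, f w * negChar w ^ u N) atTop (𝓝 0) := by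
  refine ((Real.tendsto_integral_exp_smul_cocompact f).comp hu).congr fun N => ?_
  refine integral_congr_ae (ae_of_all _ fun w => ?_)
  simp only [Circle.smul_def, Real.fourierChar_apply, smul_eq_mul]
  rw [mul_comm, ← negChar_int_mul, negChar]
  congr 2; push_cast; ring

theorem sum_Icc_sub_int (F : ℤ → ℂ) (N : ℕ) :
    ∑ n ∈ Finset.Icc (-(N : ℤ)) N, (F (n + 1) - F n) = F (N + 1) - F (-N) := by
  induction N with
  | zero => simp
  | succ N ih =>
    rw [Nat.cast_add, Nat.cast_one, Finset.Icc_succ_succ, Finset.sum_union (by simp),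
      Finset.sum_pair (by lia), ih]
    rw [show -((N : ℤ) + 1) + 1 = -N by ring]
    ring

/-- Poisson summation with symmetric partial sums on the Fourier side, for an integrable function
satisfying a Lipschitz condition at the integers. -/
theorem tendsto_sum_integral_mul_negChar {f : ℝ → ℂ} (hf : Integrable f)
    (hs : Summable fun m : ℤ => ‖f m‖) {δ C : ℝ} (hδ : 0 < δ) (hC : 0 ≤ C)
    (hL : ∀ (m : ℤ) (u : ℝ), |u| ≤ δ → ‖f (m + u) - f m‖ ≤ C * ‖f m‖ * |u|) :
    Tendsto (fun N : ℕ => ∑ n ∈ Finset.Icc (-(N : ℤ)) N, ∫ w, f w * negChar w ^ n) atTop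
      (𝓝 (∑' m : ℤ, f m)) := by
  have hφ : Integrable fun w : ℝ => f (round w) := integrable_comp_round (a := fun m => f m) hs
  -- Write `f - f ∘ round = Q (E - 1)` with `E = negChar`. The integrals of `Q Eⁿ⁺¹ - Q Eⁿ`
  -- telescope over `-N ≤ n ≤ N`, leaving two terms that vanish by the Riemann–Lebesgue lemma once
  -- `Q` is integrable.
  set Q : ℝ → ℂ := fun w => (f w - f (round w)) / (negChar w - 1) with hQ
  have hbound : ∀ w, ‖Q w‖ ≤ (4 * δ)⁻¹ * (‖f w‖ + ‖f (round w)‖) + C / 4 * ‖f (round w)‖ := by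
    intro w
    have hu : |w - round w| ≤ 1 / 2 := abs_sub_round w
    have hE : negChar w = negChar (w - round w) := by
      conv_lhs => rw [← sub_add_cancel w (round w : ℝ), negChar_add, negChar_int, mul_one]
    have hge := norm_negChar_sub_one_ge hu
    rw [← hE] at hge
    have hp1 : 0 ≤ (4 * δ)⁻¹ * (‖f w‖ + ‖f (round w)‖) := by positivity
    have hp2 : 0 ≤ C / 4 * ‖f (round w)‖ := by positivity
    -- Within `δ` of an integer the Lipschitz condition compensates the zero of `E - 1`; farther
    -- away `|E - 1| ≥ 4δ`.
    simp only [hQ, norm_div]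
    rcases eq_or_lt_of_le (norm_nonneg (negChar w - 1)) with h0 | h0
    · rw [← h0, div_zero]; positivity
    rw [div_le_iff₀ h0]
    rcases le_or_gt |w - round w| δ with h | h
    · have h1 := hL (round w) (w - round w) h
      rw [add_sub_cancel] at h1
      have h2 := mul_le_mul_of_nonneg_left hge hp2
      have h3 := mul_nonneg hp1 h0.le
      linarith
    · have h1 := norm_sub_le (f w) (f (round w))
      have h2 : 4 * δ ≤ ‖negChar w - 1‖ := by linarith
      have h3 := mul_le_mul_of_nonneg_left h2 hp1
      have h4 := mul_nonneg hp2 h0.le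
      have h5 : (4 * δ)⁻¹ * (‖f w‖ + ‖f (round w)‖) * (4 * δ) = ‖f w‖ + ‖f (round w)‖ := by
        field_simp
      linarith
  have hQi : Integrable Q := by
    refine Integrable.mono' (((hf.norm.add hφ.norm).const_mul _).add (hφ.norm.const_mul _)) ?_
      (ae_of_all _ hbound)
    simp only [hQ, div_eq_mul_inv]
    refine (hf.1.sub hφ.1).mul (Measurable.aestronglyMeasurable ?_)
    exact (continuous_negChar.measurable.sub_const 1).inv
  have hpow : ∀ {g : ℝ → ℂ} (n : ℤ), Integrable g → Integrable fun w => g w * negChar w ^ n := by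
    intro g n hg
    refine hg.mul_bdd (c := 1) ?_ (ae_of_all _ fun w => ?_)
    · simp only [← negChar_int_mul]
      exact (continuous_negChar.comp (by fun_prop)).aestronglyMeasurable
    · rw [norm_zpow, norm_negChar, one_zpow]
  have hsplit : ∀ n : ℤ, ∫ w, f w * negChar w ^ n = (∫ w : ℝ, f (round w) * negChar w ^ n) +
      ((∫ w, Q w * negChar w ^ (n + 1)) - ∫ w, Q w * negChar w ^ n) := by
    intro n
    have hd : Integrable fun w => Q w * negChar w ^ (n + 1) - Q w * negChar w ^ n :=
      (hpow _ hQi).sub (hpow _ hQi)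
    rw [← integral_sub (hpow _ hQi) (hpow _ hQi), ← integral_add (hpow n hφ) hd]
    refine integral_congr_ae (ae_of_all _ fun w => ?_)
    have hE0 : negChar w ≠ 0 := norm_ne_zero_iff.1 (by rw [norm_negChar]; exact one_ne_zero)
    have hmain : Q w * (negChar w - 1) = f w - f (round w) := by
      -- The denominator vanishes only at integers, where the numerator vanishes too, so the default
      -- value `0` of the quotient is harmless.
      by_cases h : negChar w - 1 = 0
      · have hu : |w - round w| ≤ 1 / 2 := abs_sub_round w
        have hE : negChar w = negChar (w - round w) := by
          conv_lhs => rw [← sub_add_cancel w (round w : ℝ), negChar_add, negChar_int, mul_one]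
        have hge := norm_negChar_sub_one_ge hu
        rw [← hE, h, norm_zero] at hge
        have h0 : w - round w = 0 := abs_eq_zero.1 (by linarith [abs_nonneg (w - round w)])
        rw [← sub_eq_zero.1 h0, h, mul_zero, sub_self]
      · simp only [hQ]; rw [div_mul_cancel₀ _ h]
    simp only
    rw [zpow_add_one₀ hE0]
    linear_combination (-negChar w ^ n) * hmain
  have hsum : ∀ N : ℕ, ∑ n ∈ Finset.Icc (-(N : ℤ)) N, ∫ w, f w * negChar w ^ n =
      (∑' m : ℤ, f m) + ((∫ w, Q w * negChar w ^ ((N : ℤ) + 1)) -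
        ∫ w, Q w * negChar w ^ (-(N : ℤ))) := by
    intro N
    simp only [hsplit]
    rw [Finset.sum_add_distrib, sum_Icc_sub_int (fun n => ∫ w, Q w * negChar w ^ n)]
    congr 1
    simp only [integral_comp_round_mul_negChar (a := fun m => f m) hs]
    rw [Finset.sum_ite_eq' _ (0 : ℤ), if_pos (by simp)]
  simp only [hsum]
  have h1 := tendsto_integral_mul_negChar_pow Q (u := fun N => (N : ℤ) + 1) (by
    rw [cocompact_eq_atBot_atTop]
    refine Tendsto.mono_right ?_ le_sup_right
    push_cast
    exact tendsto_atTop_add_const_right _ _ tendsto_natCast_atTop_atTop)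
  have h2 := tendsto_integral_mul_negChar_pow Q (u := fun N => -(N : ℤ)) (by
    rw [cocompact_eq_atBot_atTop]
    refine Tendsto.mono_right ?_ le_sup_left
    push_cast
    exact tendsto_neg_atTop_atBot.comp tendsto_natCast_atTop_atTop)
  simpa using (h1.sub h2).const_add (∑' m : ℤ, f m)

/-! ### The spectral representation of the quasi-periodic Green's function -/

theorem beta_sq (k ξ : ℝ) (hk : 0 < k) : beta k ξ ^ 2 = ((k ^ 2 - ξ ^ 2 : ℝ) : ℂ) := by
  rw [beta]
  split_ifs with h
  · rw [← ofReal_pow, Real.sq_sqrt (by have := sq_le_sq.2 (h.trans (le_abs_self k)); linarith)]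
  · rw [mul_pow, I_sq, ← ofReal_pow, Real.sq_sqrt]
    · push_cast; ring
    · rw [not_le] at h
      have := sq_lt_sq.2 (by rwa [abs_of_pos hk] : |k| < |ξ|)
      linarith

theorem beta_re_nonneg (k ξ : ℝ) : 0 ≤ (beta k ξ).re := by
  rw [beta]; split_ifs
  · rw [ofReal_re]; positivity
  · simp

theorem beta_im_nonneg (k ξ : ℝ) : 0 ≤ (beta k ξ).im := by
  rw [beta]; split_ifs
  · simp
  · simp

theorem le_beta_im {k : ℝ} (hk : 0 < k) (ξ : ℝ) : |ξ| - k ≤ (beta k ξ).im := by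
  rw [beta]; split_ifs with h
  · simpa using h
  · rw [not_le] at h
    simp only [mul_im, I_re, ofReal_im, mul_zero, I_im, ofReal_re, one_mul, zero_add]
    refine Real.le_sqrt_of_sq_le ?_
    nlinarith [sq_abs ξ]

theorem norm_le_norm_add {z w : ℂ} (hz : 0 ≤ z.re) (hz' : 0 ≤ z.im) (hw : 0 ≤ w.re)
    (hw' : 0 ≤ w.im) : ‖w‖ ≤ ‖z + w‖ := by
  rw [Complex.norm_def, Complex.norm_def, normSq_apply, normSq_apply, add_re, add_im]
  gcongr <;> linarith

/-- Factor `β(ξ)² - β(η)² = η² - ξ²`. Both values lie in the closed first quadrant, so their sum is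
at least as large in modulus as either of them. -/
theorem norm_beta_sub_mul_le {k : ℝ} (hk : 0 < k) (ξ η : ℝ) :
    ‖beta k ξ - beta k η‖ * ‖beta k η‖ ≤ |ξ ^ 2 - η ^ 2| := by
  calc _ ≤ ‖beta k ξ - beta k η‖ * ‖beta k ξ + beta k η‖ := by
        gcongr
        exact norm_le_norm_add (beta_re_nonneg _ _) (beta_im_nonneg _ _) (beta_re_nonneg _ _)
          (beta_im_nonneg _ _)
    _ = ‖beta k ξ ^ 2 - beta k η ^ 2‖ := by rw [← norm_mul]; congr 1; ring
    _ = |ξ ^ 2 - η ^ 2| := by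
        rw [beta_sq k ξ hk, beta_sq k η hk, ← ofReal_sub, norm_real, Real.norm_eq_abs, ← abs_neg]
        congr 1; ring

/-- Away from Wood anomalies the horizontal wave numbers are controlled by the vertical ones. -/
theorem exists_alphaN_le_mul_norm_beta {k Λ α : ℝ} (hk : 0 < k) (hΛ : 0 < Λ)
    (hα : ¬IsWoodAnomaly k Λ α) :
    ∃ K, 1 ≤ K ∧ ∀ n, |alphaN Λ α n| + 1 ≤ K * ‖beta k (alphaN Λ α n)‖ := by
  have hne : ∀ n, 0 < ‖beta k (alphaN Λ α n)‖ := by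
    intro n
    refine norm_pos_iff.2 fun h => hα ⟨n, ?_⟩
    have h1 := beta_sq k (alphaN Λ α n) hk
    rw [h, zero_pow two_ne_zero] at h1
    have h2 : k ^ 2 - alphaN Λ α n ^ 2 = 0 := by exact_mod_cast h1.symm
    rw [← abs_of_pos hk, ← sq_eq_sq_iff_abs_eq_abs]; linarith
  -- Only finitely many modes have `|αₙ| < k + 1`, and there the ratio has a maximum. For all others
  -- `|βₙ| ≥ |αₙ| - k ≥ 1`, and the constant `k + 2` works.
  obtain ⟨B, hB⟩ := ((propagating_finite (k + 1) Λ α hΛ).image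
    fun n => (|alphaN Λ α n| + 1) / ‖beta k (alphaN Λ α n)‖).bddAbove
  refine ⟨max B (k + 2), le_max_of_le_right (by linarith), fun n => ?_⟩
  rcases lt_or_ge |alphaN Λ α n| (k + 1) with h | h
  · have h1 := hB (mem_image_of_mem _ (show n ∈ propagating (k + 1) Λ α from h))
    exact ((div_le_iff₀ (hne n)).1 h1).trans
      (mul_le_mul_of_nonneg_right (le_max_left _ _) (norm_nonneg _))
  · have h1 := (le_beta_im hk (alphaN Λ α n)).trans ((le_abs_self _).trans (abs_im_le_norm _))
    refine le_trans ?_ (mul_le_mul_of_nonneg_right (le_max_right B (k + 2)) (norm_nonneg _))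
    nlinarith

theorem summable_exp_neg_mul_abs_int {c : ℝ} (hc : 0 < c) :
    Summable fun n : ℤ => Real.exp (-(c * |(n : ℝ)|)) := by
  have h : Summable fun n : ℕ => Real.exp (-(c * n)) := by
    refine (Real.summable_exp_nat_mul_iff.2 (neg_lt_zero.2 hc)).congr fun n => ?_
    congr 1; ring
  refine Summable.of_nat_of_neg ?_ ?_
  · simpa using h
  · simpa using h

theorem summable_alphaN_mul_exp {k Λ : ℝ} (α : ℝ) (hk : 0 < k) (hΛ : 0 < Λ) {c : ℝ} (hc : 0 < c) :
    Summable fun n => (|alphaN Λ α n| + 1) * Real.exp (-(c * (beta k (alphaN Λ α n)).im)) := by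
  have hd : 0 < c / 2 * (2 * Real.pi / Λ) := by positivity
  refine Summable.of_nonneg_of_le (fun n => by positivity) (fun n => ?_)
    ((summable_exp_neg_mul_abs_int hd).mul_left
      ((k + 1) * (1 + 2 / c) * Real.exp (c / 2 * (k + |α|))))
  set x := (beta k (alphaN Λ α n)).im with hx
  have hx0 : 0 ≤ x := beta_im_nonneg _ _
  have h1 : |alphaN Λ α n| - k ≤ x := le_beta_im hk _
  have h2 : |alphaN Λ α n| + 1 ≤ (k + 1) * (1 + x) := by nlinarith
  have h3 : 2 * Real.pi / Λ * |(n : ℝ)| ≤ x + k + |α| := by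
    have h4 : 2 * Real.pi / Λ * |(n : ℝ)| = |alphaN Λ α n - α| := by
      rw [alphaN, add_sub_cancel_left, abs_mul, abs_of_pos (by positivity : 0 < 2 * Real.pi / Λ)]
    rw [h4]; linarith [abs_sub (alphaN Λ α n) α]
  calc _ ≤ (k + 1) * (1 + x) * Real.exp (-(c * x)) := by gcongr
    _ = (k + 1) * ((1 + x) * Real.exp (-(c * x))) := by ring
    _ ≤ (k + 1) * ((1 + 2 / c) * Real.exp (-(c / 2 * x))) := by
        exact mul_le_mul_of_nonneg_left (one_add_mul_exp_le hc hx0) (by positivity)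
    _ ≤ (k + 1) * ((1 + 2 / c) * (Real.exp (c / 2 * (k + |α|)) *
          Real.exp (-(c / 2 * (2 * Real.pi / Λ) * |(n : ℝ)|)))) := by
        rw [← Real.exp_add]
        gcongr
        nlinarith
    _ = _ := by ring

theorem norm_planeMode (k s t ξ : ℝ) :
    ‖planeMode k s t ξ‖ = ‖beta k ξ‖⁻¹ * Real.exp (-(t * (beta k ξ).im)) := by
  rw [planeMode, norm_mul, norm_div, norm_one, one_div, Complex.norm_exp]
  congr 2
  simp; ring

theorem summable_norm_planeMode {k Λ α : ℝ} (hk : 0 < k) (hΛ : 0 < Λ)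
    (hα : ¬IsWoodAnomaly k Λ α) (s : ℝ) {t : ℝ} (ht : 0 < t) :
    Summable fun n => ‖planeMode k s t (alphaN Λ α n)‖ := by
  obtain ⟨K, hK, hKn⟩ := exists_alphaN_le_mul_norm_beta hk hΛ hα
  refine Summable.of_nonneg_of_le (fun n => norm_nonneg _) (fun n => ?_)
    ((summable_alphaN_mul_exp α hk hΛ ht).mul_left K)
  rw [norm_planeMode, ← mul_assoc]
  gcongr
  have h1 := hKn n
  have h2 := abs_nonneg (alphaN Λ α n)
  rw [inv_le_iff_one_le_mul₀ (by nlinarith)]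
  nlinarith

theorem norm_exp_sub_one_le_mul_exp {z : ℂ} {L : ℝ} (hz : ‖z‖ ≤ L) :
    ‖cexp z - 1‖ ≤ ‖z‖ * Real.exp L := by
  have h := norm_exp_sub_sum_le_norm_mul_exp z 1
  simp only [Finset.range_one, Finset.sum_singleton, pow_zero, Nat.factorial_zero, Nat.cast_one,
    div_one, pow_one] at h
  exact h.trans (by gcongr)

/-- This is the local hypothesis of the Poisson summation, with radius and constant independent of
`n`. Since `|βₙ| ≥ 1/K` and `β` moves by at most `2K|v|`, the radius `(4K²)⁻¹` keeps `|β|` at least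
half of `|βₙ|`. The bound is relative to the mode itself, as summability over `n` requires. -/
theorem planeMode_lipschitz {k Λ α : ℝ} (hk : 0 < k) {K : ℝ} (hK : 1 ≤ K)
    (hKn : ∀ n, |alphaN Λ α n| + 1 ≤ K * ‖beta k (alphaN Λ α n)‖) (s : ℝ) {t : ℝ} (ht : 0 < t)
    (n : ℤ) {v : ℝ} (hv : |v| ≤ (4 * K ^ 2)⁻¹) :
    ‖planeMode k s t (alphaN Λ α n + v) - planeMode k s t (alphaN Λ α n)‖ ≤
      (2 * (|s| + 2 * K * t) * Real.exp (|s| + 2 * K * t) + 4 * K ^ 2) *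
        ‖planeMode k s t (alphaN Λ α n)‖ * |v| := by
  set a := alphaN Λ α n with ha
  set b := beta k a with hb
  set b' := beta k (a + v) with hb'
  have hv1 : |v| ≤ 1 := hv.trans (inv_le_one_of_one_le₀ (by nlinarith))
  have hKb : |a| + 1 ≤ K * ‖b‖ := hKn n
  have hb0 : 0 < ‖b‖ := by have := abs_nonneg a; nlinarith
  have hdiff : ‖b' - b‖ ≤ 2 * K * |v| := by
    refine le_of_mul_le_mul_right ?_ hb0
    refine (norm_beta_sub_mul_le hk (a + v) a).trans ?_
    rw [show (a + v) ^ 2 - a ^ 2 = v * (2 * a + v) by ring, abs_mul]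
    have h1 : |2 * a + v| ≤ 2 * (|a| + 1) := by
      refine (abs_add_le _ _).trans ?_
      rw [abs_mul, abs_two]; linarith
    calc |v| * |2 * a + v| ≤ |v| * (2 * (K * ‖b‖)) := by gcongr; linarith
      _ = _ := by ring
  have hKv : 4 * K ^ 2 * |v| ≤ 1 := by
    have := mul_le_mul_of_nonneg_left hv (by positivity : 0 ≤ 4 * K ^ 2)
    rwa [mul_inv_cancel₀ (by positivity)] at this
  have hKb1 : 1 ≤ K * ‖b‖ := by linarith [abs_nonneg a]
  have hhalf : ‖b‖ ≤ 2 * ‖b'‖ := by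
    have h1 : ‖b‖ - ‖b'‖ ≤ ‖b' - b‖ := by rw [norm_sub_rev]; exact norm_sub_norm_le b b'
    have h2 : 2 * K * |v| * 2 ≤ ‖b‖ := by
      refine le_of_mul_le_mul_left ?_ (by linarith : 0 < K)
      nlinarith
    linarith
  have hb'0 : 0 < ‖b'‖ := by linarith
  set D : ℂ := I * v * s + I * (b' - b) * t with hD
  have hDn : ‖D‖ ≤ (|s| + 2 * K * t) * |v| := by
    refine (norm_add_le _ _).trans ?_
    rw [norm_mul, norm_mul, norm_mul, norm_mul, norm_I, norm_real, norm_real, norm_real,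
      Real.norm_eq_abs, Real.norm_eq_abs, Real.norm_of_nonneg ht.le, one_mul, one_mul]
    nlinarith
  have hL : 0 ≤ |s| + 2 * K * t := by positivity
  have hDL : ‖D‖ ≤ |s| + 2 * K * t := hDn.trans (mul_le_of_le_one_right hL hv1)
  have hfac : planeMode k s t (a + v) - planeMode k s t a =
      planeMode k s t a * (b / b' * (cexp D - 1) + (b - b') / b') := by
    have hb0' : b ≠ 0 := norm_pos_iff.1 hb0
    have hb'0' : b' ≠ 0 := norm_pos_iff.1 hb'0
    have hexp : cexp (I * ((a + v : ℝ) : ℂ) * s + I * b' * t) =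
        cexp (I * a * s + I * b * t) * cexp D := by
      rw [← Complex.exp_add]; congr 1; push_cast; ring
    rw [planeMode, planeMode, ← hb, ← hb', hexp]
    field_simp; ring
  have h1 : ‖b / b'‖ ≤ 2 := by rw [norm_div, div_le_iff₀ hb'0]; exact hhalf
  have h2 : ‖(b - b') / b'‖ ≤ 4 * K ^ 2 * |v| := by
    rw [norm_div, norm_sub_rev, div_le_iff₀ hb'0]
    have h3 : 1 ≤ 2 * K * ‖b'‖ := by nlinarith
    calc ‖b' - b‖ ≤ 2 * K * |v| * 1 := by linarith
      _ ≤ 2 * K * |v| * (2 * K * ‖b'‖) := by gcongr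
      _ = _ := by ring
  have h3 := (norm_exp_sub_one_le_mul_exp hDL).trans
    (mul_le_mul_of_nonneg_right hDn (Real.exp_pos _).le)
  rw [hfac, norm_mul]
  calc _ ≤ ‖planeMode k s t a‖ * (2 * ((|s| + 2 * K * t) * |v| * Real.exp (|s| + 2 * K * t)) +
        4 * K ^ 2 * |v|) := by
        gcongr
        refine (norm_add_le _ _).trans (add_le_add ?_ h2)
        rw [norm_mul]
        gcongr
    _ = _ := by ring

theorem dist_image_eq (Λ : ℝ) (x y : Plane) (n : ℤ) :
    dist x (image Λ y n) = √((x 0 - y 0 - n * Λ) ^ 2 + (x 1 - y 1) ^ 2) := by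
  rw [EuclideanSpace.dist_eq, Fin.sum_univ_two, Real.dist_eq, Real.dist_eq, sq_abs, sq_abs]
  simp only [image, PiLp.toLp_apply, Matrix.cons_val_zero, Matrix.cons_val_one]
  congr 3; ring

/-- With `ξ = α + 2πw/Λ`, a shift of the source by `nΛ` multiplies the plane wave by `exp (-inΛα)`
times the `n`-th power of `negChar w`. The quasi-periodic phase removes the first factor. -/
theorem greenTerm_eq_integral {k Λ : ℝ} (α : ℝ) (hk : 0 < k) (hΛ : 0 < Λ) {x y : Plane}
    (hxy : y 1 < x 1) (n : ℤ) :
    greenTerm k Λ α x y n = I / (2 * Λ) * ∫ w : ℝ,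
      planeMode k (x 0 - y 0) (x 1 - y 1) (α + 2 * Real.pi / Λ * w) * negChar w ^ n := by
  have hpi : (Real.pi : ℂ) ≠ 0 := by exact_mod_cast Real.pi_ne_zero
  have hΛ' : (Λ : ℂ) ≠ 0 := by exact_mod_cast hΛ.ne'
  have ht : 0 < x 1 - y 1 := sub_pos.2 hxy
  have h1 := integral_planeMode hk (x 0 - y 0 - n * Λ) ht
  have h2 := Measure.integral_comp_mul_left
    (fun ξ => planeMode k (x 0 - y 0 - n * Λ) (x 1 - y 1) (α + ξ)) (2 * Real.pi / Λ)
  rw [integral_add_left_eq_self (fun ξ => planeMode k (x 0 - y 0 - n * Λ) (x 1 - y 1) ξ) α, h1]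
    at h2
  have h3 : ∀ w : ℝ, planeMode k (x 0 - y 0) (x 1 - y 1) (α + 2 * Real.pi / Λ * w) * negChar w ^ n =
      planeMode k (x 0 - y 0 - n * Λ) (x 1 - y 1) (α + 2 * Real.pi / Λ * w) *
        cexp (I * n * Λ * α) := by
    intro w
    rw [planeMode, planeMode, mul_assoc (1 / _), mul_assoc (1 / _), ← negChar_int_mul, negChar,
      ← Complex.exp_add,
      ← Complex.exp_add]
    congr 2; push_cast; field_simp; ring
  simp only [h3]
  rw [integral_mul_const, h2, greenTerm, dist_image_eq, abs_of_pos (by positivity), real_smul]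
  push_cast
  field_simp
  ring

/-- Poisson summation for the function of `w` in `greenTerm_eq_integral`, whose values at the
integers are the modes `αₙ`. -/
theorem hasSum_greenTerm {k Λ α : ℝ} (hk : 0 < k) (hΛ : 0 < Λ) (hα : ¬IsWoodAnomaly k Λ α)
    {x y : Plane} (hxy : y 1 < x 1) :
    HasSum (greenTerm k Λ α x y)
      (I / (2 * Λ) * ∑' n, planeMode k (x 0 - y 0) (x 1 - y 1) (alphaN Λ α n))
      (SummationFilter.symmetricIcc ℤ) := by
  obtain ⟨K, hK, hKn⟩ := exists_alphaN_le_mul_norm_beta hk hΛ hα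
  have ht : 0 < x 1 - y 1 := sub_pos.2 hxy
  have hc : 0 < 2 * Real.pi / Λ := by positivity
  set f : ℝ → ℂ := fun w => planeMode k (x 0 - y 0) (x 1 - y 1) (α + 2 * Real.pi / Λ * w) with hf
  have hfi : Integrable f :=
    ((integrable_planeMode hk (x 0 - y 0) ht).comp_add_left α).comp_mul_left' hc.ne'
  set C := (2 * (|x 0 - y 0| + 2 * K * (x 1 - y 1)) * Real.exp (|x 0 - y 0| +
    2 * K * (x 1 - y 1)) + 4 * K ^ 2) with hC
  have hC0 : 0 ≤ C := by positivity
  have key := tendsto_sum_integral_mul_negChar (f := f) (δ := (4 * K ^ 2)⁻¹ / (2 * Real.pi / Λ))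
    (C := C * (2 * Real.pi / Λ)) hfi (summable_norm_planeMode hk hΛ hα _ ht) (by positivity)
    (by positivity) ?_
  · rw [HasSum, SummationFilter.symmetricIcc_eq_map_Icc_nat, tendsto_map'_iff]
    refine (key.const_mul (I / (2 * Λ))).congr fun N => ?_
    simp only [Function.comp, greenTerm_eq_integral α hk hΛ hxy, ← Finset.mul_sum, hf]
  · intro m u hu
    have h := planeMode_lipschitz hk hK hKn (x 0 - y 0) ht m (v := 2 * Real.pi / Λ * u) (by
      rw [abs_mul, abs_of_pos hc, mul_comm]; exact (le_div_iff₀ hc).1 hu)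
    have h1 : f (m + u) =
        planeMode k (x 0 - y 0) (x 1 - y 1) (alphaN Λ α m + 2 * Real.pi / Λ * u) := by
      simp only [hf, alphaN]; congr 1; ring
    rw [h1]
    refine h.trans (le_of_eq ?_)
    rw [abs_mul, abs_of_pos hc]
    simp only [hf, alphaN, hC]
    ring

theorem green_eq_tsum {k Λ α : ℝ} (hk : 0 < k) (hΛ : 0 < Λ) (hα : ¬IsWoodAnomaly k Λ α)
    {x y : Plane} (hxy : y 1 < x 1) :
    green k Λ α x y =
      I / (2 * Λ) * ∑' n, planeMode k (x 0 - y 0) (x 1 - y 1) (alphaN Λ α n) :=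
  (hasSum_greenTerm hk hΛ hα hxy).tsum_eq

/-! ### Orthogonality of the modes on a period -/

theorem integral_exp_alphaN_sub {Λ : ℝ} (hΛ : 0 < Λ) (α : ℝ) (n m : ℤ) :
    ∫ τ in (-(Λ / 2))..(Λ / 2), cexp (-(I * alphaN Λ α n * τ)) * cexp (I * alphaN Λ α m * τ) =
      if n = m then (Λ : ℂ) else 0 := by
  have hΛ' : (Λ : ℂ) ≠ 0 := by exact_mod_cast hΛ.ne'
  have hpi : (Real.pi : ℂ) ≠ 0 := by exact_mod_cast Real.pi_ne_zero
  have h1 : ∀ τ : ℝ, cexp (-(I * alphaN Λ α n * τ)) * cexp (I * alphaN Λ α m * τ) =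
      cexp (2 * Real.pi * I * (m - n) / Λ * τ) := fun τ => by
    rw [← Complex.exp_add, alphaN, alphaN]; congr 1; push_cast; ring
  simp only [h1]
  split_ifs with h
  · simp [h]
  · have hmn : (m - n : ℂ) ≠ 0 := by
      rw [sub_ne_zero]; exact_mod_cast Ne.symm h
    have hc : 2 * Real.pi * I * (m - n) / Λ ≠ 0 := by
      simp [hpi, hΛ', hmn]
    rw [integral_exp_mul_complex hc, div_eq_zero_iff, sub_eq_zero]
    left
    rw [Complex.exp_eq_exp_iff_exists_int]
    refine ⟨m - n, ?_⟩
    push_cast; field_simp; ring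

theorem norm_exp_I_mul_real_mul_real (a b : ℝ) : ‖cexp (I * a * b)‖ = 1 := by
  rw [mul_assoc, ← ofReal_mul, norm_exp_I_mul_real]

theorem norm_exp_neg_I_mul_real_mul_real (a b : ℝ) : ‖cexp (-(I * a * b))‖ = 1 := by
  rw [Complex.exp_neg, norm_inv, norm_exp_I_mul_real_mul_real, inv_one]

theorem continuous_tsum_mul_exp {a : ℤ → ℂ} (ha : Summable fun n => ‖a n‖) (Λ α : ℝ) :
    Continuous fun τ : ℝ => ∑' n, a n * cexp (I * alphaN Λ α n * τ) :=
  continuous_tsum (fun n => by fun_prop) ha fun n τ => by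
    rw [norm_mul, norm_exp_I_mul_real_mul_real, mul_one]

theorem continuous_tsum_mul_exp_neg {a : ℤ → ℂ} (ha : Summable fun n => ‖a n‖) (Λ α : ℝ) :
    Continuous fun τ : ℝ => ∑' n, a n * cexp (-(I * alphaN Λ α n * τ)) :=
  continuous_tsum (fun n => by fun_prop) ha fun n τ => by
    rw [norm_mul, norm_exp_neg_I_mul_real_mul_real, mul_one]

/-- The product is an absolutely summable double series, integrated termwise; orthogonality removes
everything off the diagonal. -/
theorem integral_tsum_mul_tsum {Λ : ℝ} (hΛ : 0 < Λ) (α : ℝ) {a b : ℤ → ℂ}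
    (ha : Summable fun n => ‖a n‖) (hb : Summable fun n => ‖b n‖) :
    ∫ τ in (-(Λ / 2))..(Λ / 2), (∑' n, a n * cexp (-(I * alphaN Λ α n * τ))) *
      (∑' n, b n * cexp (I * alphaN Λ α n * τ)) = ∑' n, Λ * (a n * b n) := by
  have hab : Summable fun p : ℤ × ℤ => ‖a p.1‖ * ‖b p.2‖ :=
    ha.mul_of_nonneg hb (fun _ => norm_nonneg _) fun _ => norm_nonneg _
  let F : ℤ × ℤ → ℝ → ℂ := fun p τ => (a p.1 * cexp (-(I * alphaN Λ α p.1 * τ))) *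
    (b p.2 * cexp (I * alphaN Λ α p.2 * τ))
  have hFn : ∀ p τ, ‖F p τ‖ = ‖a p.1‖ * ‖b p.2‖ := fun p τ => by
    simp only [F, norm_mul, norm_exp_I_mul_real_mul_real, norm_exp_neg_I_mul_real_mul_real, mul_one]
  have hna : ∀ τ : ℝ, Summable fun n => ‖a n * cexp (-(I * alphaN Λ α n * τ))‖ := fun τ => by
    simpa only [norm_mul, norm_exp_neg_I_mul_real_mul_real, mul_one] using ha
  have hnb : ∀ τ : ℝ, Summable fun n => ‖b n * cexp (I * alphaN Λ α n * τ)‖ := fun τ => by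
    simpa only [norm_mul, norm_exp_I_mul_real_mul_real, mul_one] using hb
  have h := intervalIntegral.hasSum_integral_of_dominated_convergence (μ := volume)
    (a := -(Λ / 2)) (b := Λ / 2) (F := F)
    (f := fun τ => (∑' n, a n * cexp (-(I * alphaN Λ α n * τ))) *
      (∑' n, b n * cexp (I * alphaN Λ α n * τ)))
    (fun p _ => ‖a p.1‖ * ‖b p.2‖)
    (fun p => Continuous.aestronglyMeasurable (by simp only [F]; fun_prop))
    (fun p => ae_of_all _ fun τ _ => (hFn p τ).le) (ae_of_all _ fun τ _ => hab)
    (by simp) (ae_of_all _ fun τ _ => by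
      rw [tsum_mul_tsum_of_summable_norm (hna τ) (hnb τ)]
      exact (summable_mul_of_summable_norm (hna τ) (hnb τ)).hasSum)
  have hF : ∀ p, ∫ τ in (-(Λ / 2))..(Λ / 2), F p τ =
      if p.1 = p.2 then Λ * (a p.1 * b p.2) else 0 := fun p => by
    have h1 : ∀ τ, F p τ = a p.1 * b p.2 *
        (cexp (-(I * alphaN Λ α p.1 * τ)) * cexp (I * alphaN Λ α p.2 * τ)) := fun τ => by
      simp only [F]; ring
    simp only [h1]
    rw [intervalIntegral.integral_const_mul, integral_exp_alphaN_sub hΛ]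
    split_ifs <;> ring
  rw [← h.tsum_eq, h.summable.tsum_prod]
  refine tsum_congr fun n => ?_
  simp only [hF]
  rw [tsum_eq_single n (fun m hm => if_neg fun h' => hm h'.symm), if_pos rfl]

theorem summable_norm_conj {a : ℤ → ℂ} (ha : Summable fun n => ‖a n‖) :
    Summable fun n => ‖conj (a n)‖ := by
  simpa only [RCLike.norm_conj] using ha

/-! ### Mode amplitudes -/

/-- The amplitude on `Γ_h` of the `n`-th mode radiated by a point source at `z`. -/
def amplitude (k Λ α h : ℝ) (z : Plane) (n : ℤ) : ℂ :=
  I / (2 * Λ) * planeMode k (-z 0) (h - z 1) (alphaN Λ α n)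

/-- The vertical derivative of `amplitude`. -/
def amplitudeDeriv (k Λ α h : ℝ) (z : Plane) (n : ℤ) : ℂ :=
  I * beta k (alphaN Λ α n) * amplitude k Λ α h z n

theorem planeMode_shift (k τ s t ξ : ℝ) :
    planeMode k (τ - s) t ξ = planeMode k (-s) t ξ * cexp (I * ξ * τ) := by
  rw [planeMode, planeMode, mul_assoc (1 / _), ← Complex.exp_add]; congr 2; push_cast; ring

theorem hasDerivAt_planeMode (k s t ξ : ℝ) :
    HasDerivAt (fun t => planeMode k s t ξ) (I * beta k ξ * planeMode k s t ξ) t := by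
  have h := ((((hasDerivAt_id' t).ofReal_comp.const_mul (I * beta k ξ)).const_add
    (I * ξ * s)).cexp).const_mul (1 / beta k ξ)
  refine h.congr_deriv ?_
  rw [planeMode]; push_cast; ring

theorem norm_deriv_planeMode_le (k s t ξ : ℝ) :
    ‖I * beta k ξ * planeMode k s t ξ‖ ≤ Real.exp (-(t * (beta k ξ).im)) := by
  rw [norm_mul, norm_mul, norm_I, one_mul, norm_planeMode, ← mul_assoc]
  exact mul_le_of_le_one_left (Real.exp_pos _).le mul_inv_le_one

theorem summable_exp_beta {k Λ : ℝ} (α : ℝ) (hk : 0 < k) (hΛ : 0 < Λ) {c : ℝ} (hc : 0 < c) :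
    Summable fun n => Real.exp (-(c * (beta k (alphaN Λ α n)).im)) :=
  Summable.of_nonneg_of_le (fun n => (Real.exp_pos _).le)
    (fun n => le_mul_of_one_le_left (Real.exp_pos _).le (by linarith [abs_nonneg (alphaN Λ α n)]))
    (summable_alphaN_mul_exp α hk hΛ hc)

theorem summable_norm_amplitude {k Λ α h : ℝ} (hk : 0 < k) (hΛ : 0 < Λ)
    (hα : ¬IsWoodAnomaly k Λ α) {z : Plane} (hz : z 1 < h) :
    Summable fun n => ‖amplitude k Λ α h z n‖ := by
  simp only [amplitude, norm_mul]
  exact (summable_norm_planeMode hk hΛ hα _ (sub_pos.2 hz)).mul_left _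

theorem summable_norm_amplitudeDeriv {k Λ h : ℝ} (α : ℝ) (hk : 0 < k) (hΛ : 0 < Λ)
    {z : Plane} (hz : z 1 < h) :
    Summable fun n => ‖amplitudeDeriv k Λ α h z n‖ := by
  refine Summable.of_nonneg_of_le (fun n => norm_nonneg _) (fun n => ?_)
    ((summable_exp_beta α hk hΛ (sub_pos.2 hz)).mul_left ‖I / (2 * Λ)‖)
  rw [amplitudeDeriv, amplitude, mul_left_comm, norm_mul]
  gcongr
  exact norm_deriv_planeMode_le _ _ _ _

theorem green_eq_tsum_amplitude {k Λ α h : ℝ} (hk : 0 < k) (hΛ : 0 < Λ)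
    (hα : ¬IsWoodAnomaly k Λ α) {z : Plane} (hz : z 1 < h) (τ : ℝ) :
    green k Λ α !₂[τ, h] z =
      ∑' n, amplitude k Λ α h z n * cexp (I * alphaN Λ α n * τ) := by
  rw [green_eq_tsum hk hΛ hα (by simpa using hz), ← tsum_mul_left]
  refine tsum_congr fun n => ?_
  simp only [Matrix.cons_val_zero, Matrix.cons_val_one, planeMode_shift,
    amplitude, mul_assoc]

theorem hasDerivAt_green {k Λ α h : ℝ} (hk : 0 < k) (hΛ : 0 < Λ)
    (hα : ¬IsWoodAnomaly k Λ α) {z : Plane} (hz : z 1 < h) (τ : ℝ) :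
    HasDerivAt (fun t : ℝ => green k Λ α !₂[τ, t] z)
      (∑' n, amplitudeDeriv k Λ α h z n * cexp (I * alphaN Λ α n * τ)) h := by
  have ht : 0 < h - z 1 := sub_pos.2 hz
  have h1 := hasDerivAt_tsum_of_isPreconnected
    (g := fun n t => amplitude k Λ α t z n * cexp (I * alphaN Λ α n * τ))
    (g' := fun n t => amplitudeDeriv k Λ α t z n * cexp (I * alphaN Λ α n * τ))
    -- Staying above the midpoint between source and line keeps half of the vertical gap as a
    -- uniform decay rate for the derivatives.
    (t := Ioi ((h + z 1) / 2)) (y₀ := h) (y := h)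
    ((summable_exp_beta α hk hΛ (half_pos ht)).mul_left ‖I / (2 * Λ)‖)
    isOpen_Ioi isPreconnected_Ioi ?_ ?_ (show (h + z 1) / 2 < h by linarith) ?_
    (show (h + z 1) / 2 < h by linarith)
  · refine h1.congr_of_eventuallyEq ?_
    filter_upwards [lt_mem_nhds hz] with t ht using green_eq_tsum_amplitude hk hΛ hα ht τ
  · intro n t _
    have h2 := (hasDerivAt_planeMode k (-z 0) (t - z 1) (alphaN Λ α n)).comp_sub_const t (z 1)
    refine ((h2.const_mul (I / (2 * Λ))).mul_const (cexp (I * alphaN Λ α n * τ))).congr_deriv ?_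
    rw [amplitudeDeriv, amplitude]; ring
  · intro n t ht'
    have ht' : (h + z 1) / 2 < t := ht'
    rw [norm_mul, norm_exp_I_mul_real_mul_real, mul_one, amplitudeDeriv, amplitude, mul_left_comm,
      norm_mul]
    gcongr
    refine (norm_deriv_planeMode_le _ _ _ _).trans (Real.exp_le_exp.2 (neg_le_neg ?_))
    exact mul_le_mul_of_nonneg_right (by linarith) (beta_im_nonneg _ _)
  · refine Summable.of_norm ?_
    simpa only [norm_mul, norm_exp_I_mul_real_mul_real, mul_one] using
      summable_norm_amplitude hk hΛ hα hz

theorem vertDeriv_green {k Λ α h : ℝ} (hk : 0 < k) (hΛ : 0 < Λ)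
    (hα : ¬IsWoodAnomaly k Λ α) {z : Plane} (hz : z 1 < h) (τ : ℝ) :
    vertDeriv (fun w => green k Λ α w z) !₂[τ, h] =
      ∑' n, amplitudeDeriv k Λ α h z n * cexp (I * alphaN Λ α n * τ) :=
  (hasDerivAt_green hk hΛ hα hz τ).deriv

theorem conj_tsum_mul_exp (a : ℤ → ℂ) (Λ α τ : ℝ) :
    conj (∑' n, a n * cexp (I * alphaN Λ α n * τ)) =
      ∑' n, conj (a n) * cexp (-(I * alphaN Λ α n * τ)) := by
  rw [conj_tsum]
  refine tsum_congr fun n => ?_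
  rw [map_mul, ← exp_conj]
  simp

theorem vertDeriv_conj_green {k Λ α h : ℝ} (hk : 0 < k) (hΛ : 0 < Λ)
    (hα : ¬IsWoodAnomaly k Λ α) {z : Plane} (hz : z 1 < h) (τ : ℝ) :
    vertDeriv (fun w => conj (green k Λ α w z)) !₂[τ, h] =
      ∑' n, conj (amplitudeDeriv k Λ α h z n) * cexp (-(I * alphaN Λ α n * τ)) := by
  rw [← conj_tsum_mul_exp]
  exact (conjCLE.toContinuousLinearMap.hasFDerivAt.comp_hasDerivAt h
    (hasDerivAt_green hk hΛ hα hz τ)).deriv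

theorem corrLeft_eq {k Λ α h : ℝ} (hk : 0 < k) (hΛ : 0 < Λ)
    (hα : ¬IsWoodAnomaly k Λ α) {y z : Plane} (hy : y 1 < h) (hz : z 1 < h) (τ : ℝ) :
    corrLeft k Λ α y z !₂[τ, h] =
      (∑' n, conj (amplitudeDeriv k Λ α h y n) * cexp (-(I * alphaN Λ α n * τ))) *
        ∑' n, amplitude k Λ α h z n * cexp (I * alphaN Λ α n * τ) := by
  rw [corrLeft, vertDeriv_conj_green hk hΛ hα hy, green_eq_tsum_amplitude hk hΛ hα hz]

theorem corrRight_eq {k Λ α h : ℝ} (hk : 0 < k) (hΛ : 0 < Λ)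
    (hα : ¬IsWoodAnomaly k Λ α) {y z : Plane} (hy : y 1 < h) (hz : z 1 < h) (τ : ℝ) :
    corrRight k Λ α y z !₂[τ, h] =
      (∑' n, conj (amplitude k Λ α h y n) * cexp (-(I * alphaN Λ α n * τ))) *
        ∑' n, amplitudeDeriv k Λ α h z n * cexp (I * alphaN Λ α n * τ) := by
  rw [corrRight, vertDeriv_green hk hΛ hα hz, green_eq_tsum_amplitude hk hΛ hα hy,
    conj_tsum_mul_exp, mul_comm]

theorem segIntegrable_corrLeft {k Λ α h : ℝ} (hk : 0 < k) (hΛ : 0 < Λ)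
    (hα : ¬IsWoodAnomaly k Λ α) {y z : Plane} (hy : y 1 < h) (hz : z 1 < h) :
    SegIntegrable Λ h (corrLeft k Λ α y z) := by
  rw [SegIntegrable, funext (corrLeft_eq hk hΛ hα hy hz)]
  refine Continuous.intervalIntegrable ?_ _ _
  exact (continuous_tsum_mul_exp_neg (summable_norm_conj
    (summable_norm_amplitudeDeriv α hk hΛ hy)) Λ α).mul
    (continuous_tsum_mul_exp (summable_norm_amplitude hk hΛ hα hz) Λ α)

theorem segIntegrable_corrRight {k Λ α h : ℝ} (hk : 0 < k) (hΛ : 0 < Λ)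
    (hα : ¬IsWoodAnomaly k Λ α) {y z : Plane} (hy : y 1 < h) (hz : z 1 < h) :
    SegIntegrable Λ h (corrRight k Λ α y z) := by
  rw [SegIntegrable, funext (corrRight_eq hk hΛ hα hy hz)]
  refine Continuous.intervalIntegrable ?_ _ _
  exact (continuous_tsum_mul_exp_neg (summable_norm_conj
    (summable_norm_amplitude hk hΛ hα hy)) Λ α).mul
    (continuous_tsum_mul_exp (summable_norm_amplitudeDeriv α hk hΛ hz) Λ α)

theorem segIntegral_corrLeft {k Λ α h : ℝ} (hk : 0 < k) (hΛ : 0 < Λ)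
    (hα : ¬IsWoodAnomaly k Λ α) {y z : Plane} (hy : y 1 < h) (hz : z 1 < h) :
    segIntegral Λ h (corrLeft k Λ α y z) =
      ∑' n, Λ * (conj (amplitudeDeriv k Λ α h y n) * amplitude k Λ α h z n) := by
  rw [segIntegral, funext (corrLeft_eq hk hΛ hα hy hz), integral_tsum_mul_tsum hΛ α
    (summable_norm_conj (summable_norm_amplitudeDeriv α hk hΛ hy))
    (summable_norm_amplitude hk hΛ hα hz)]

theorem segIntegral_corrRight {k Λ α h : ℝ} (hk : 0 < k) (hΛ : 0 < Λ)
    (hα : ¬IsWoodAnomaly k Λ α) {y z : Plane} (hy : y 1 < h) (hz : z 1 < h) :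
    segIntegral Λ h (corrRight k Λ α y z) =
      ∑' n, Λ * (conj (amplitude k Λ α h y n) * amplitudeDeriv k Λ α h z n) := by
  rw [segIntegral, funext (corrRight_eq hk hΛ hα hy hz), integral_tsum_mul_tsum hΛ α
    (summable_norm_conj (summable_norm_amplitude hk hΛ hα hy))
    (summable_norm_amplitudeDeriv α hk hΛ hz)]

/-! ### Propagating and evanescent parts of the correlation -/

theorem conj_beta_propagating {k Λ α : ℝ} {n : ℤ} (hn : n ∈ propagating k Λ α) :
    conj (beta k (alphaN Λ α n)) = beta k (alphaN Λ α n) := by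
  have hn : |alphaN Λ α n| < k := hn
  rw [beta, if_pos hn.le, conj_ofReal]

theorem conj_beta_evanescent {k Λ α : ℝ} (hα : ¬IsWoodAnomaly k Λ α) {n : ℤ}
    (hn : n ∉ propagating k Λ α) :
    conj (beta k (alphaN Λ α n)) = -beta k (alphaN Λ α n) := by
  have hn : ¬|alphaN Λ α n| < k := hn
  have hn' : ¬|alphaN Λ α n| ≤ k := fun h => hα ⟨n, le_antisymm h (not_lt.1 hn)⟩
  rw [beta, if_neg hn', map_mul, conj_I, conj_ofReal, neg_mul]

theorem beta_alphaN_ne_zero {k Λ α : ℝ} (hk : 0 < k) (hΛ : 0 < Λ) (hα : ¬IsWoodAnomaly k Λ α)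
    (n : ℤ) : beta k (alphaN Λ α n) ≠ 0 := by
  obtain ⟨K, _, hK⟩ := exists_alphaN_le_mul_norm_beta hk hΛ hα
  intro h
  have := hK n
  rw [h, norm_zero, mul_zero] at this
  linarith [abs_nonneg (alphaN Λ α n)]

open Classical in
/-- The contribution of the `n`-th mode to the point spread function. -/
def spreadTerm (k Λ α : ℝ) (y z : Plane) (n : ℤ) : ℂ :=
  if n ∈ propagating k Λ α then
    1 / beta k (alphaN Λ α n) * cexp (I * (alphaN Λ α n : ℂ) * ((y 0 - z 0 : ℝ) : ℂ) +
      I * beta k (alphaN Λ α n) * ((y 1 - z 1 : ℝ) : ℂ))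
  else 0

open Classical in
/-- The contribution of the `n`-th mode to the remainder. -/
def remainderTerm (k Λ α h : ℝ) (y z : Plane) (n : ℤ) : ℂ :=
  if n ∈ propagating k Λ α then 0
  else -I / (4 * Λ * beta k (alphaN Λ α n)) *
    cexp (I * (alphaN Λ α n : ℂ) * ((y 0 - z 0 : ℝ) : ℂ) +
      I * beta k (alphaN Λ α n) * ((2 * h - (y 1 + z 1) : ℝ) : ℂ))

theorem finite_support_spreadTerm {k Λ : ℝ} (α : ℝ) (hΛ : 0 < Λ) (y z : Plane) :
    (Function.support (spreadTerm k Λ α y z)).Finite := by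
  refine (propagating_finite k Λ α hΛ).subset fun n hn => ?_
  by_contra h
  exact hn (by rw [spreadTerm, if_neg h])

theorem summable_spreadTerm {k Λ : ℝ} (α : ℝ) (hΛ : 0 < Λ) (y z : Plane) :
    Summable (spreadTerm k Λ α y z) :=
  summable_of_hasFiniteSupport (finite_support_spreadTerm α hΛ y z)

open Classical in
theorem pointSpreadU_eq_tsum {k Λ : ℝ} (α : ℝ) (hΛ : 0 < Λ) (y z : Plane) :
    pointSpreadU k Λ α y z = I / (2 * Λ) * ∑' n, spreadTerm k Λ α y z n := by
  rw [tsum_eq_finsum (finite_support_spreadTerm α hΛ y z), pointSpreadU]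
  congr 1
  refine finsum_congr fun n => ?_
  rw [spreadTerm]
  split_ifs with h
  · rw [finsum_eq_if, if_pos h]; rfl
  · rw [finsum_eq_if, if_neg h]

/-- For real `βₙ` the phases in `h` cancel under conjugation and `y₂ - z₂` remains. For imaginary
`βₙ` conjugation changes its sign, so the vertical distances add up to `2h - (y₂ + z₂)`. -/
theorem leftTerm_eq {k Λ α h : ℝ} (hk : 0 < k) (hΛ : 0 < Λ) (hα : ¬IsWoodAnomaly k Λ α)
    (y z : Plane) (n : ℤ) :
    Λ * (conj (amplitudeDeriv k Λ α h y n) * amplitude k Λ α h z n) =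
      -(1 / 2) * (I / (2 * Λ) * spreadTerm k Λ α y z n) + remainderTerm k Λ α h y z n := by
  have hb := beta_alphaN_ne_zero hk hΛ hα n
  have hΛ' : (Λ : ℂ) ≠ 0 := by exact_mod_cast hΛ.ne'
  have he : ∀ p q r : ℂ, r = p + q → cexp r = cexp p * cexp q := fun p q r hr => by
    rw [hr, Complex.exp_add]
  rw [amplitudeDeriv, amplitude, amplitude, planeMode, planeMode, spreadTerm, remainderTerm]
  simp only [map_mul, map_div₀, conj_I, conj_ofReal, map_one, map_ofNat, ← exp_conj, map_add]
  split_ifs with hn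
  · rw [conj_beta_propagating hn]
    rw [he (-I * alphaN Λ α n * ((-y 0 : ℝ) : ℂ) + -I * beta k (alphaN Λ α n) * ((h - y 1 : ℝ) : ℂ))
      (I * alphaN Λ α n * ((-z 0 : ℝ) : ℂ) + I * beta k (alphaN Λ α n) * ((h - z 1 : ℝ) : ℂ))
      (I * alphaN Λ α n * ((y 0 - z 0 : ℝ) : ℂ) + I * beta k (alphaN Λ α n) *
        ((y 1 - z 1 : ℝ) : ℂ)) (by push_cast; ring)]
    generalize cexp _ = X
    generalize cexp _ = Y
    field_simp
    linear_combination (I * X * Y) * I_sq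
  · rw [conj_beta_evanescent hα hn]
    rw [he (-I * alphaN Λ α n * ((-y 0 : ℝ) : ℂ) +
        -I * -beta k (alphaN Λ α n) * ((h - y 1 : ℝ) : ℂ))
      (I * alphaN Λ α n * ((-z 0 : ℝ) : ℂ) + I * beta k (alphaN Λ α n) * ((h - z 1 : ℝ) : ℂ))
      (I * alphaN Λ α n * ((y 0 - z 0 : ℝ) : ℂ) + I * beta k (alphaN Λ α n) *
        ((2 * h - (y 1 + z 1) : ℝ) : ℂ)) (by push_cast; ring)]
    generalize cexp _ = X
    generalize cexp _ = Y
    field_simp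
    linear_combination (4 * X * Y) * I_sq

/-- The right term is the negative of the left one for a propagating mode, which doubles the half in
`leftTerm_eq`, and equal to it for an evanescent mode. -/
theorem leftTerm_sub_rightTerm {k Λ α h : ℝ} (hk : 0 < k) (hΛ : 0 < Λ) (hα : ¬IsWoodAnomaly k Λ α)
    (y z : Plane) (n : ℤ) :
    Λ * (conj (amplitudeDeriv k Λ α h y n) * amplitude k Λ α h z n) -
      Λ * (conj (amplitude k Λ α h y n) * amplitudeDeriv k Λ α h z n) =
      -(I / (2 * Λ) * spreadTerm k Λ α y z n) := by
  by_cases hn : n ∈ propagating k Λ α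
  · have h1 : Λ * (conj (amplitude k Λ α h y n) * amplitudeDeriv k Λ α h z n) =
        -(Λ * (conj (amplitudeDeriv k Λ α h y n) * amplitude k Λ α h z n)) := by
      rw [amplitudeDeriv, amplitudeDeriv, map_mul, map_mul, conj_I, conj_beta_propagating hn]; ring
    rw [h1, leftTerm_eq hk hΛ hα, remainderTerm, if_pos hn]; ring
  · rw [spreadTerm, if_neg hn, amplitudeDeriv, amplitudeDeriv, map_mul, map_mul, conj_I,
      conj_beta_evanescent hα hn]
    ring

theorem summable_conj_mul {a b : ℤ → ℂ} (ha : Summable fun n => ‖a n‖)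
    (hb : Summable fun n => ‖b n‖) (c : ℂ) : Summable fun n => c * (conj (a n) * b n) := by
  refine (Summable.of_norm ?_).mul_left c
  obtain ⟨B, hB⟩ := hb.tendsto_cofinite_zero.bddAbove_range_of_cofinite
  refine Summable.of_nonneg_of_le (fun n => norm_nonneg _) (fun n => ?_) (ha.mul_right B)
  rw [norm_mul, RCLike.norm_conj]
  exact mul_le_mul_of_nonneg_left (hB (mem_range_self n)) (norm_nonneg _)

theorem segIntegral_corrLeft_sub_corrRight {k Λ α h : ℝ} (hk : 0 < k) (hΛ : 0 < Λ)
    (hα : ¬IsWoodAnomaly k Λ α) {y z : Plane} (hy : y 1 < h) (hz : z 1 < h) :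
    segIntegral Λ h (fun x => corrLeft k Λ α y z x - corrRight k Λ α y z x) =
      -pointSpreadU k Λ α y z := by
  have h1 : segIntegral Λ h (fun x => corrLeft k Λ α y z x - corrRight k Λ α y z x) =
      segIntegral Λ h (corrLeft k Λ α y z) - segIntegral Λ h (corrRight k Λ α y z) :=
    intervalIntegral.integral_sub (segIntegrable_corrLeft hk hΛ hα hy hz)
      (segIntegrable_corrRight hk hΛ hα hy hz)
  rw [h1, segIntegral_corrLeft hk hΛ hα hy hz, segIntegral_corrRight hk hΛ hα hy hz,
    ← Summable.tsum_sub (summable_conj_mul (summable_norm_amplitudeDeriv α hk hΛ hy)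
      (summable_norm_amplitude hk hΛ hα hz) _) (summable_conj_mul
      (summable_norm_amplitude hk hΛ hα hy) (summable_norm_amplitudeDeriv α hk hΛ hz) _),
    pointSpreadU_eq_tsum α hΛ, ← tsum_mul_left, ← tsum_neg]
  exact tsum_congr fun n => leftTerm_sub_rightTerm hk hΛ hα y z n

theorem remainderU_eq_tsum {k Λ α h : ℝ} (hk : 0 < k) (hΛ : 0 < Λ)
    (hα : ¬IsWoodAnomaly k Λ α) {y z : Plane} (hy : y 1 < h) (hz : z 1 < h) :
    remainderU k Λ α h y z = ∑' n, remainderTerm k Λ α h y z n := by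
  have hs := summable_conj_mul (summable_norm_amplitudeDeriv α hk hΛ hy)
      (summable_norm_amplitude hk hΛ hα hz) Λ
  have h1 : ∀ n, remainderTerm k Λ α h y z n =
      Λ * (conj (amplitudeDeriv k Λ α h y n) * amplitude k Λ α h z n) -
        -(1 / 2) * (I / (2 * Λ) * spreadTerm k Λ α y z n) := fun n => by
    rw [leftTerm_eq hk hΛ hα]; ring
  rw [remainderU, segIntegral_corrLeft hk hΛ hα hy hz, pointSpreadU_eq_tsum α hΛ,
    ← tsum_mul_left, ← tsum_mul_left, ← Summable.tsum_sub hs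
      (((summable_spreadTerm α hΛ y z).mul_left _).mul_left _)]
  exact tsum_congr fun n => (h1 n).symm

/-! ### Decay of the remainder -/

/-- The horizontal offset `y₁ - z₁` as a continuous linear map. -/
def horizontalOffset : Plane × Plane →L[ℝ] ℂ :=
  ofRealCLM.comp ((EuclideanSpace.proj (0 : Fin 2)).comp
    (ContinuousLinearMap.fst ℝ Plane Plane - ContinuousLinearMap.snd ℝ Plane Plane))

/-- The total height `y₂ + z₂` as a continuous linear map. -/
def totalHeight : Plane × Plane →L[ℝ] ℝ :=
  (EuclideanSpace.proj (1 : Fin 2)).comp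
    (ContinuousLinearMap.fst ℝ Plane Plane + ContinuousLinearMap.snd ℝ Plane Plane)

theorem horizontalOffset_apply (p : Plane × Plane) :
    horizontalOffset p = ((p.1 0 - p.2 0 : ℝ) : ℂ) := rfl

theorem totalHeight_apply (p : Plane × Plane) : totalHeight p = p.1 1 + p.2 1 := rfl

/-- The phase gradient of the `n`-th remainder term. -/
def phaseGradient (k Λ α : ℝ) (n : ℤ) : Plane × Plane →L[ℝ] ℂ :=
  (I * (alphaN Λ α n : ℂ)) • horizontalOffset -
    (I * beta k (alphaN Λ α n)) • ofRealCLM.comp totalHeight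

theorem hasFDerivAt_remainderTerm (k Λ α h : ℝ) (n : ℤ) (p : Plane × Plane) :
    HasFDerivAt (fun p : Plane × Plane => remainderTerm k Λ α h p.1 p.2 n)
      (remainderTerm k Λ α h p.1 p.2 n • phaseGradient k Λ α n) p := by
  by_cases hn : n ∈ propagating k Λ α
  · have h0 : ∀ p : Plane × Plane, remainderTerm k Λ α h p.1 p.2 n = 0 := fun p => by
      rw [remainderTerm, if_pos hn]
    simp only [h0]
    exact (hasFDerivAt_const (0 : ℂ) p).congr_fderiv (by ext <;> simp)
  · have h1 : ∀ p : Plane × Plane, remainderTerm k Λ α h p.1 p.2 n =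
        -I / (4 * Λ * beta k (alphaN Λ α n)) * cexp (phaseGradient k Λ α n p +
          I * beta k (alphaN Λ α n) * (2 * h)) := fun p => by
      rw [remainderTerm, if_neg hn]
      congr 2
      simp only [phaseGradient, sub_apply, smul_apply,
        ContinuousLinearMap.comp_apply, horizontalOffset_apply, totalHeight_apply, smul_eq_mul,
        ofRealCLM_apply]
      push_cast; ring
    simp only [h1]
    refine ((((phaseGradient k Λ α n).hasFDerivAt (x := p)).add_const
      (I * beta k (alphaN Λ α n) * (2 * h))).cexp.const_mul
      (-I / (4 * Λ * beta k (alphaN Λ α n)))).congr_fderiv ?_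
    rw [smul_smul]

theorem norm_beta_le {k : ℝ} (hk : 0 < k) (ξ : ℝ) : ‖beta k ξ‖ ≤ k + |ξ| := by
  refine (pow_le_pow_iff_left₀ (norm_nonneg _) (by positivity) two_ne_zero).1 ?_
  rw [← norm_pow, beta_sq k ξ hk, norm_real, Real.norm_eq_abs, abs_le]
  constructor <;> nlinarith [sq_abs ξ, abs_nonneg ξ]

theorem norm_phaseGradient_le {k : ℝ} (hk : 0 < k) (Λ α : ℝ) (n : ℤ) :
    ‖phaseGradient k Λ α n‖ ≤ (k + 1) * (‖horizontalOffset‖ + ‖ofRealCLM.comp totalHeight‖) *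
      (|alphaN Λ α n| + 1) := by
  have h1 := norm_beta_le hk (alphaN Λ α n)
  have h2 := abs_nonneg (alphaN Λ α n)
  refine (norm_sub_le _ _).trans ?_
  rw [norm_smul, norm_smul, norm_mul, norm_mul, norm_I, one_mul, one_mul, norm_real,
    Real.norm_eq_abs]
  have h3 : |alphaN Λ α n| ≤ (k + 1) * (|alphaN Λ α n| + 1) := by nlinarith
  have h4 : ‖beta k (alphaN Λ α n)‖ ≤ (k + 1) * (|alphaN Λ α n| + 1) := by nlinarith
  calc _ ≤ (k + 1) * (|alphaN Λ α n| + 1) * ‖horizontalOffset‖ +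
        (k + 1) * (|alphaN Λ α n| + 1) * ‖ofRealCLM.comp totalHeight‖ := by gcongr
    _ = _ := by ring

theorem beta_eq_I_mul_im {k Λ α : ℝ} {n : ℤ} (hα : ¬IsWoodAnomaly k Λ α)
    (hn : n ∉ propagating k Λ α) :
    beta k (alphaN Λ α n) = I * ((beta k (alphaN Λ α n)).im : ℂ) := by
  have h := congrArg re (conj_beta_evanescent hα hn)
  rw [conj_re, neg_re] at h
  refine Complex.ext ?_ ?_
  · simp; linarith
  · simp

theorem norm_remainderTerm_le {k Λ α : ℝ} (hΛ : 0 < Λ)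
    (hα : ¬IsWoodAnomaly k Λ α) {K : ℝ} (hK : 1 ≤ K)
    (hKn : ∀ n, |alphaN Λ α n| + 1 ≤ K * ‖beta k (alphaN Λ α n)‖) {h : ℝ} (hh : 1 ≤ h)
    {y z : Plane} (hyz : h ≤ 2 * h - (y 1 + z 1)) (n : ℤ) :
    ‖remainderTerm k Λ α h y z n‖ ≤ K ^ 2 / (2 * Λ) *
      Real.exp (-(1 / 2 * (beta k (alphaN Λ α n)).im)) * h⁻¹ := by
  by_cases hn : n ∈ propagating k Λ α
  · rw [remainderTerm, if_pos hn, norm_zero]; positivity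
  have hb := beta_eq_I_mul_im hα hn
  have hg0 := beta_im_nonneg k (alphaN Λ α n)
  have hKb := hKn n
  rw [remainderTerm, if_neg hn]
  rw [hb] at hKb ⊢
  generalize (beta k (alphaN Λ α n)).im = g at *
  rw [norm_mul, norm_I, one_mul, norm_real, Real.norm_of_nonneg hg0] at hKb
  have hg1 : 1 ≤ K * g := by linarith [abs_nonneg (alphaN Λ α n)]
  have hg : 0 < g := by nlinarith
  have hexp : ‖cexp (I * (alphaN Λ α n : ℂ) * ((y 0 - z 0 : ℝ) : ℂ) +
      I * (I * g) * ((2 * h - (y 1 + z 1) : ℝ) : ℂ))‖ ≤ Real.exp (-(g * h)) := by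
    rw [Complex.norm_exp]
    refine Real.exp_le_exp.2 ?_
    have h1 : (I * (alphaN Λ α n : ℂ) * ((y 0 - z 0 : ℝ) : ℂ) +
      I * (I * g) * ((2 * h - (y 1 + z 1) : ℝ) : ℂ)) =
        ((alphaN Λ α n * (y 0 - z 0) : ℝ) : ℂ) * I + ((-(g * (2 * h - (y 1 + z 1))) : ℝ) : ℂ) := by
      push_cast
      linear_combination (g * (2 * h - (y 1 + z 1)) : ℂ) * I_sq
    rw [h1, add_re, re_ofReal_mul, I_re, mul_zero, zero_add, ofReal_re]
    exact neg_le_neg (mul_le_mul_of_nonneg_left hyz hg.le)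
  -- The exponential is split in halves: one yields `1/h` through `x ≤ exp x` and `g ≥ 1/K`, the
  -- other is kept, using `h ≥ 1`, for the summation over `n`.
  have hdecay : Real.exp (-(g * h)) ≤ 2 * K * h⁻¹ * Real.exp (-(1 / 2 * g)) := by
    have h1 : Real.exp (-(g * h / 2)) ≤ 2 * K * h⁻¹ := by
      rw [Real.exp_neg]
      have h2 : g * h / 2 ≤ Real.exp (g * h / 2) := by linarith [Real.add_one_le_exp (g * h / 2)]
      have h3 : h / (2 * K) ≤ Real.exp (g * h / 2) := by
        refine le_trans ?_ h2
        rw [div_le_iff₀ (by positivity)]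
        nlinarith
      calc _ ≤ (h / (2 * K))⁻¹ := inv_anti₀ (by positivity) h3
        _ = _ := by field_simp
    calc Real.exp (-(g * h)) ≤ Real.exp (-(g * h / 2)) * Real.exp (-(1 / 2 * g)) := by
          rw [← Real.exp_add]
          exact Real.exp_le_exp.2 (by nlinarith)
      _ ≤ _ := by gcongr
  have hcoef : ‖-I / (4 * Λ * (I * g))‖ ≤ K / (4 * Λ) := by
    rw [norm_div, norm_neg, norm_mul, norm_mul, norm_mul, norm_I, norm_real, norm_real,
      Real.norm_of_nonneg hΛ.le, Real.norm_of_nonneg hg.le, div_le_div_iff₀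
        (by simp; positivity) (by positivity)]
    simp only [RCLike.norm_ofNat]
    nlinarith
  have him : (I * (g : ℂ)).im = g := by simp
  rw [norm_mul, him]
  calc _ ≤ K / (4 * Λ) * (2 * K * h⁻¹ * Real.exp (-(1 / 2 * g))) := by
        gcongr
        exact hexp.trans hdecay
    _ = _ := by field_simp; ring

/-- On the half space `y₂ + z₂ < S` with `S ≤ h` the distance `2h - (y₂ + z₂)` exceeds `h`, so the
termwise bounds are uniform there. The half space is open and convex, as termwise differentiation
requires, and differentiating costs only a factor of order `|αₙ| + 1`. -/
theorem exists_bound_remainderU {k Λ α : ℝ} (hk : 0 < k) (hΛ : 0 < Λ)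
    (hα : ¬IsWoodAnomaly k Λ α) (S : ℝ) :
    ∃ C, ∀ h : ℝ, 1 ≤ h → S ≤ h → ∀ y z : Plane, y 1 < h → z 1 < h → y 1 + z 1 < S →
      ‖remainderU k Λ α h y z‖ ≤ C * h⁻¹ ∧
      DifferentiableAt ℝ (fun p : Plane × Plane => remainderU k Λ α h p.1 p.2) (y, z) ∧
      ‖fderiv ℝ (fun p : Plane × Plane => remainderU k Λ α h p.1 p.2) (y, z)‖ ≤ C * h⁻¹ := by
  obtain ⟨K, hK, hKn⟩ := exists_alphaN_le_mul_norm_beta hk hΛ hα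
  set A := (k + 1) * (‖horizontalOffset‖ + ‖ofRealCLM.comp totalHeight‖) with hA
  have hA0 : 0 ≤ A := by positivity
  let u : ℤ → ℝ := fun n => (|alphaN Λ α n| + 1) *
    Real.exp (-(1 / 2 * (beta k (alphaN Λ α n)).im))
  have hu : Summable u := summable_alphaN_mul_exp α hk hΛ one_half_pos
  have hu0 : 0 ≤ ∑' n, u n := tsum_nonneg fun n => by positivity
  refine ⟨(1 + A) * (K ^ 2 / (2 * Λ)) * ∑' n, u n, fun h hh hS y z hy hz hyz => ?_⟩
  have hterm : ∀ p : Plane × Plane, p.1 1 + p.2 1 < S → ∀ n,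
      ‖remainderTerm k Λ α h p.1 p.2 n‖ ≤ K ^ 2 / (2 * Λ) * h⁻¹ * u n := by
    intro p hp n
    refine (norm_remainderTerm_le hΛ hα hK hKn hh (by linarith) n).trans ?_
    rw [mul_right_comm]
    gcongr
    exact le_mul_of_one_le_left (Real.exp_pos _).le (by linarith [abs_nonneg (alphaN Λ α n)])
  have hterm' : ∀ p : Plane × Plane, p.1 1 + p.2 1 < S → ∀ n,
      ‖remainderTerm k Λ α h p.1 p.2 n • phaseGradient k Λ α n‖ ≤
        A * (K ^ 2 / (2 * Λ)) * h⁻¹ * u n := by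
    intro p hp n
    rw [norm_smul]
    calc _ ≤ K ^ 2 / (2 * Λ) * Real.exp (-(1 / 2 * (beta k (alphaN Λ α n)).im)) * h⁻¹ *
          (A * (|alphaN Λ α n| + 1)) := by
          gcongr
          · exact norm_remainderTerm_le hΛ hα hK hKn hh (by linarith) n
          · exact norm_phaseGradient_le hk Λ α n
      _ = _ := by simp only [u]; ring
  have hS' : Summable fun n => remainderTerm k Λ α h y z n :=
    Summable.of_norm_bounded (hu.mul_left _) (hterm (y, z) hyz)
  have hU : {p : Plane × Plane | p.1 1 + p.2 1 < S} = totalHeight ⁻¹' Iio S := rfl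
  have hd := hasFDerivAt_tsum_of_isPreconnected (𝕜 := ℝ)
    (f := fun n (p : Plane × Plane) => remainderTerm k Λ α h p.1 p.2 n)
    (f' := fun n p => remainderTerm k Λ α h p.1 p.2 n • phaseGradient k Λ α n)
    (s := {p : Plane × Plane | p.1 1 + p.2 1 < S}) (x₀ := (y, z)) (x := (y, z))
    (hu.mul_left (A * (K ^ 2 / (2 * Λ)) * h⁻¹))
    (by rw [hU]; exact isOpen_Iio.preimage totalHeight.continuous)
    (by rw [hU]; exact ((convex_Iio S).linear_preimage totalHeight.toLinearMap).isPreconnected)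
    (fun n p _ => hasFDerivAt_remainderTerm k Λ α h n p) (fun n p hp => hterm' p hp n)
    hyz hS' hyz
  -- The series represents the remainder only for points below `Γ_h`; this is an open condition, so
  -- the derivatives agree.
  have hev : (fun p : Plane × Plane => remainderU k Λ α h p.1 p.2) =ᶠ[𝓝 (y, z)]
      fun p => ∑' n, remainderTerm k Λ α h p.1 p.2 n := by
    have h1 : Tendsto (fun p : Plane × Plane => p.1 1) (𝓝 (y, z)) (𝓝 (y 1)) :=
      (by fun_prop : Continuous fun p : Plane × Plane => p.1 1).tendsto (y, z)
    have h2 : Tendsto (fun p : Plane × Plane => p.2 1) (𝓝 (y, z)) (𝓝 (z 1)) :=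
      (by fun_prop : Continuous fun p : Plane × Plane => p.2 1).tendsto (y, z)
    filter_upwards [h1.eventually_lt_const hy, h2.eventually_lt_const hz] with p hp hp'
      using remainderU_eq_tsum hk hΛ hα hp hp'
  have hd' := hd.congr_of_eventuallyEq hev
  have hh0 : 0 < h := by linarith
  refine ⟨?_, hd'.differentiableAt, ?_⟩
  · rw [remainderU_eq_tsum hk hΛ hα hy hz]
    refine (tsum_of_norm_bounded (hu.mul_left _).hasSum (hterm (y, z) hyz)).trans ?_
    rw [tsum_mul_left]
    have h3 : 0 ≤ A * (K ^ 2 / (2 * Λ) * h⁻¹ * ∑' n, u n) := by positivity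
    nlinarith
  · rw [hd'.fderiv]
    refine (tsum_of_norm_bounded (hu.mul_left _).hasSum (hterm' (y, z) hyz)).trans ?_
    rw [tsum_mul_left]
    have h3 : 0 ≤ K ^ 2 / (2 * Λ) * h⁻¹ * ∑' n, u n := by positivity
    nlinarith

end QuasiPeriodic

end

/-! ### Assembly of the exact identity and the asymptotics -/

open QuasiPeriodic

theorem theorem2p2 (k Λ α : ℝ) (hk : 0 < k) (hΛ : 0 < Λ) (hα : ¬ IsWoodAnomaly k Λ α) :
    -- the identity on `Γ_h`, together with the fact that its left side is well defined
    (∀ h : ℝ, 0 < h → ∀ y ∈ cellBelow Λ h, ∀ z ∈ cellBelow Λ h,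
      (∀ x : Plane, x 1 = h → ∀ w ∈ ({y, z} : Set Plane),
        Summable (greenTerm k Λ α x w) (SummationFilter.symmetricIcc ℤ) ∧
        DifferentiableAt ℝ (fun t : ℝ => green k Λ α !₂[x 0, t] w) h) ∧
      SegIntegrable Λ h (corrLeft k Λ α y z) ∧
      SegIntegrable Λ h (corrRight k Λ α y z) ∧
      segIntegral Λ h (fun x => corrLeft k Λ α y z x - corrRight k Λ α y z x) =
        - pointSpreadU k Λ α y z) ∧
    -- the one-sided asymptotics as `h → ∞`, for the remainder and its gradient in `(y, z)`,
    -- uniformly for `y`, `z` in bounded parts of the cell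
    (∀ M : ℝ, ∃ C h₀ : ℝ, 0 < h₀ ∧ ∀ h : ℝ, h₀ ≤ h →
      ∀ y ∈ cellBelow Λ h, ∀ z ∈ cellBelow Λ h, |y 1| ≤ M → |z 1| ≤ M →
        ‖remainderU k Λ α h y z‖ ≤ C * h⁻¹ ∧
        DifferentiableAt ℝ (fun p : Plane × Plane => remainderU k Λ α h p.1 p.2) (y, z) ∧
        ‖fderiv ℝ (fun p : Plane × Plane => remainderU k Λ α h p.1 p.2) (y, z)‖ ≤ C * h⁻¹) := by
  refine ⟨fun h _ y hy z hz => ⟨fun x hx w hw => ?_, segIntegrable_corrLeft hk hΛ hα hy.2 hz.2,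
    segIntegrable_corrRight hk hΛ hα hy.2 hz.2,
    segIntegral_corrLeft_sub_corrRight hk hΛ hα hy.2 hz.2⟩, fun M => ?_⟩
  · have hw' : w 1 < h := by
      rcases hw with rfl | rfl
      exacts [hy.2, hz.2]
    exact ⟨(hasSum_greenTerm hk hΛ hα (by rwa [hx])).summable,
      (hasDerivAt_green hk hΛ hα hw' (x 0)).differentiableAt⟩
  -- The bounds by `M` give `y₂ + z₂ ≤ 2M`; the extra `1` supplies the strict inequality defining
  -- the open half space.
  · obtain ⟨C, hC⟩ := exists_bound_remainderU hk hΛ hα (2 * M + 1)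
    refine ⟨C, max 1 (2 * M + 1), by positivity, fun h hh y hy z hz hyM hzM => ?_⟩
    refine hC h ((le_max_left _ _).trans hh) ((le_max_right _ _).trans hh) y z hy.2 hz.2 ?_
    linarith [le_abs_self (y 1), le_abs_self (z 1)]
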